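/- Let $\mathcal K$ be a locally presentable abelian category and $\mathcal S$ a set of objects of $\mathcal K$. Put $\mathcal C=\mathcal S^{\perp}=\{B\in\mathcal K:\operatorname{Ext}^1_{\mathcal K}(S,B)=0\text{ for all }S\in\mathcal S\}$ and $\mathcal F={}^{\perp}\mathcal C=\{A\in\mathcal K:\operatorname{Ext}^1_{\mathcal K}(A,B)=0\text{ for all }B\in\mathcal C\}$, so that $(\mathcal F,\mathcal C)$ is the cotorsion theory generated by $\mathcal S$ (one has $\mathcal C=\mathcal F^\perp$ and $\mathcal F={}^\perp\mathcal C$). Let $\mathrm{Filt}(\mathcal S)$ be the class of all transfinitely iterated extensions, in the sense of the directed colimit, of objects of $\mathcal S$, that is, of all objects $F$ for which there are an ordinal $\alpha$ and a commutative diagram $(f_{ij}\colon F_i\to F_j)_{i<j\le\alpha}$ in $\mathcal K$ such that $F_0=0$, $F_\alpha\cong F$, $F_j=\varinjlim_{i<j}F_i$ for every limit ordinal $j\le\alpha$, and for every $i<\alpha$ the morphism $f_{i,i+1}$ is a monomorphism whose cokernel is isomorphic to an object of $\mathcal S$. (Exactness of directed colimits in $\mathcal K$ is not assumed.) Then: (a)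 $\mathrm{Filt}(\mathcal S)\subseteq\mathcal F$; (b) if an object $X$ of $\mathcal K$ is a subobject of an object of $\mathcal C$, then there is a short exact sequence $0\to X\to C\to F'\to 0$ in $\mathcal K$ with $C\in\mathcal C$ and $F'\in\mathrm{Filt}(\mathcal S)$; (c) if an object $Y$ of $\mathcal K$ is a quotient of an object of $\mathrm{Filt}(\mathcal S)$, then there is a short exact sequence $0\to C'\to F\to Y\to 0$ in $\mathcal K$ with $C'\in\mathcal C$ and $F\in\mathrm{Filt}(\mathcal S)$; (d) if an object $G$ of $\mathcal F$ is a quotient of an object of $\mathrm{Filt}(\mathcal S)$, then $G$ is a direct summand of an object of $\mathrm{Filt}(\mathcal S)$. -/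

import Mathlib

open CategoryTheory CategoryTheory.Limits
open scoped ZeroObject

universe w w' v u

namespace EklofTrlifaj

variable {K : Type u} [Category.{v} K] [Abelian K]

/-- `Ext¹(A, B) = 0`. The Ext group of Mathlib is taken in the universe `max u v`, where it always
exists; `extOneVanishes_iff` shows that the choice of the universe is irrelevant. -/
def ExtOneVanishes (A B : K) : Prop :=
  letI : HasExt.{max u v} K := HasExt.standard K
  Subsingleton (Abelian.Ext.{max u v} A B 1)

lemma extOneVanishes_iff [HasExt.{w'} K] (A B : K) :
    ExtOneVanishes A B ↔ Subsingleton (Abelian.Ext.{w'} A B 1) := by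
  let _ : HasExt.{max u v} K := HasExt.standard K
  exact (Abelian.Ext.chgUniv.{w'} (X := A) (Y := B) (n := 1)).subsingleton_congr

/-- The class `𝒜^⊥` of all objects `B` such that `Ext¹(A, B) = 0` for all `A` in `𝒜`. -/
def rightPerp (𝒜 : ObjectProperty K) : ObjectProperty K :=
  fun B => ∀ A, 𝒜 A → ExtOneVanishes A B

/-- The class `^⊥ℬ` of all objects `A` such that `Ext¹(A, B) = 0` for all `B` in `ℬ`. -/
def leftPerp (ℬ : ObjectProperty K) : ObjectProperty K :=
  fun A => ∀ B, ℬ B → ExtOneVanishes A B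

/-- A pair of classes of objects `(ℱ, 𝒞)` is a cotorsion theory if `𝒞 = ℱ^⊥` and `ℱ = ^⊥𝒞`. -/
structure IsCotorsionTheory (ℱ 𝒞 : ObjectProperty K) : Prop where
  right_eq : 𝒞 = rightPerp ℱ
  left_eq : ℱ = leftPerp 𝒞

/-- `(ℱ, 𝒞)` is the cotorsion theory generated by `𝒮`: a cotorsion theory with `𝒞 = 𝒮^⊥`. -/
structure IsCotorsionTheoryGeneratedBy (𝒮 ℱ 𝒞 : ObjectProperty K) : Prop
    extends IsCotorsionTheory ℱ 𝒞 where
  eq_rightPerp : 𝒞 = rightPerp 𝒮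

/-- Every class of objects generates a cotorsion theory. -/
lemma isCotorsionTheoryGeneratedBy (𝒮 : ObjectProperty K) :
    IsCotorsionTheoryGeneratedBy 𝒮 (leftPerp (rightPerp 𝒮)) (rightPerp 𝒮) where
  right_eq := by
    ext B
    exact ⟨fun hB A hA => hA B hB, fun hB A hA => hB A fun B' hB' => hB' A hA⟩
  left_eq := rfl
  eq_rightPerp := rfl

/-- The class of `𝒜`-monomorphisms: monomorphisms whose cokernel is (isomorphic to) an object
of `𝒜`. -/
def monoWithCokernelIn (𝒜 : ObjectProperty K) : MorphismProperty K :=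
  fun _ _ f => Mono f ∧ 𝒜.isoClosure (cokernel f)

/-- The class `Filt(𝒮)` of all transfinitely iterated extensions, in the sense of the directed
colimit, of objects of `𝒮`: the objects `X` such that `0 ⟶ X` is the transfinite composition of
a smooth chain of `𝒮`-monomorphisms, indexed by some `w`-small well-ordered set. That is,
there is a smooth chain that starts with a zero object, in which each step from an index to its
successor is a monomorphism with cokernel isomorphic to an object of `𝒮`, and whose colimit
(its last term, when there is one) is `X`. No exactness of directed colimits is required. -/
def filt (𝒮 : ObjectProperty K) : ObjectProperty K :=
  fun X => MorphismProperty.transfiniteCompositions.{w} (monoWithCokernelIn 𝒮) (0 : (0 : K) ⟶ X)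

/-- `G` is a direct summand of `P`. -/
def IsDirectSummand (G P : K) : Prop :=
  ∃ H : K, Nonempty (G ⊞ H ≅ P)

end EklofTrlifaj

/-! Everything rests on a lifting property: if Ext¹(S, B) = 0, a monomorphism with cokernel S lifts
against every epimorphism with kernel B (`hasLiftingProperty_of_extOneVanishes`). Left lifting
classes are closed under transfinite composition in any category, so transfinite compositions of
𝒮-monomorphisms lift against epimorphisms with kernel in 𝒮^⊥, whether or not directed colimits are
exact. Applied to 0 → X and an extension of X, this splits the extension and gives (a), through
`extOneVanishes_of_forall_exists_section`.

For the rest, `exists_small_monoWithCokernelIn` yields a small set of 𝒮-monomorphisms such that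
every object with the extension property for them lies in 𝒮^⊥. The small object argument then
produces, for each X, a transfinite composition X → Y of 𝒮-monomorphisms with Y in 𝒮^⊥. This map
need not be mono; but if X embeds in some B in 𝒮^⊥, lifting against B → 0 factors the embedding
through it, so it is. Its cokernel is its pushout along X → 0, hence lies in Filt(𝒮): this is (b).
For (c), the construction is applied to the kernel of P → Y and pushed out along the inclusion into
P. For (d), the sequence of (c) splits.

All this needs transfinite compositions of 𝒮-monomorphisms to be stable under cobase change and
under iteration. Both are proved for `SmoothChain`, which keeps the target out of the chain, so that
chains refining the steps of a chain concatenate lexicographically without repeated terms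
(`smoothChains_smoothChains_le`). -/

namespace EklofTrlifaj

/-! ### Vanishing of Ext¹, split extensions and lifting properties. -/

section Ext

variable {K : Type u} [Category.{v} K] [Abelian K]

open Abelian

/-- A short exact sequence whose extension class lies in a vanishing `Ext¹` splits. -/
lemma ExtOneVanishes.exists_section {A B E : K} (h : ExtOneVanishes A B) {i : B ⟶ E} {p : E ⟶ A}
    {zero : i ≫ p = 0} (hS : (ShortComplex.mk i p zero).ShortExact) :
    ∃ s : A ⟶ E, s ≫ p = 𝟙 A := by
  let _ : HasExt.{max u v} K := HasExt.standard K
  have h : Subsingleton (Ext.{max u v} A B 1) := h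
  obtain ⟨x, hx⟩ := Ext.covariant_sequence_exact₃ A hS (n₀ := 0) (n₁ := 1) (Ext.mk₀ (𝟙 A)) rfl
    (Subsingleton.elim (α := Ext A B 1) _ _)
  obtain ⟨s, rfl⟩ := (Ext.mk₀_bijective _ _).2 x
  exact ⟨s, (Ext.mk₀_bijective _ _).1 (by simpa using hx)⟩

/-- A monomorphism with cokernel `S` has the left lifting property with respect to epimorphisms
with kernel `B` as soon as `Ext¹(S, B) = 0`. -/
lemma hasLiftingProperty_of_extOneVanishes {X Y S B E F : K} {f : X ⟶ Y} {π : Y ⟶ S}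
    {i : B ⟶ E} {p : E ⟶ F} {w₁ : f ≫ π = 0} {w₂ : i ≫ p = 0}
    (h₁ : (ShortComplex.mk f π w₁).ShortExact) (h₂ : (ShortComplex.mk i p w₂).ShortExact)
    (h : ExtOneVanishes S B) : HasLiftingProperty f p where
  sq_hasLift {x y} sq := by
    let _ : HasExt.{max u v} K := HasExt.standard K
    have h : Subsingleton (Ext.{max u v} S B 1) := h
    -- The obstruction to lifting `y` lies in Ext¹(Y, B). It restricts to zero along `f`, because `f
    -- ≫ y` lifts to `x`, so it comes from Ext¹(S, B) = 0.
    obtain ⟨z, hz⟩ : ∃ z : Y ⟶ E, z ≫ p = y := by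
      obtain ⟨o, ho⟩ := Ext.contravariant_sequence_exact₂ h₁ B
        ((Ext.mk₀ y).comp h₂.extClass (zero_add 1)) (by
          rw [Ext.mk₀_comp_mk₀_assoc, ← sq.w, ← Ext.mk₀_comp_mk₀_assoc]
          erw [h₂.comp_extClass]
          simp)
      rw [Subsingleton.elim (α := Ext S B 1) o 0, Ext.comp_zero] at ho
      obtain ⟨x, hx⟩ := Ext.covariant_sequence_exact₃ Y h₂ (n₀ := 0) (n₁ := 1) (Ext.mk₀ y) rfl
        ho.symm
      obtain ⟨s, rfl⟩ := (Ext.mk₀_bijective _ _).2 x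
      exact ⟨s, (Ext.mk₀_bijective _ _).1 (by simpa using hx)⟩
    have : Mono i := h₂.mono_f
    let b : X ⟶ B := h₂.exact.lift (x - f ≫ z) (by
      simp [hz, sq.w])
    have hb : b ≫ i = x - f ≫ z := h₂.exact.lift_f _ _
    -- The lift `z` may disagree with `x` on X. The difference takes values in B and extends to Y,
    -- again by Ext¹(S, B) = 0, which corrects `z`.
    obtain ⟨c, hc⟩ : ∃ c : Y ⟶ B, f ≫ c = b := by
      obtain ⟨x, hx⟩ := Ext.contravariant_sequence_exact₁ h₁ B (n₀ := 0) (n₁ := 1)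
        (Ext.mk₀ b) rfl (Subsingleton.elim (α := Ext S B 1) _ _)
      obtain ⟨s, rfl⟩ := (Ext.mk₀_bijective _ _).2 x
      exact ⟨s, (Ext.mk₀_bijective _ _).1 (by simpa using hx)⟩
    exact ⟨⟨{ l := z + c ≫ i
              fac_left := by rw [Preadditive.comp_add, reassoc_of% hc, hb]; abel
              fac_right := by simp [hz, w₂] }⟩⟩

open HomologicalComplex in
/-- If `s` is a quasi-isomorphism from `B` placed in degree `-1` to a complex `L` concentrated in
degrees `≥ -1`, then `B` is the kernel of the first differential of `L`. -/
lemma nonempty_iso_cycles_of_quasiIso_singleFunctor {B : K} {L : CochainComplex K ℤ}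
    [L.IsStrictlyGE (-1)] (s : (CochainComplex.singleFunctor K (-1)).obj B ⟶ L) [QuasiIso s] :
    Nonempty (B ≅ L.cycles (-1)) := by
  have h₁ : IsIso (L.homologyπ (-1)) := L.isIso_homologyπ (-2) (-1) (by simp)
    ((L.isZero_of_isStrictlyGE (-1) (-2) (by simp)).eq_of_src _ _)
  have h₂ : IsIso (homologyMap s (-1)) :=
    (quasiIsoAt_iff_isIso_homologyMap s (-1)).1 inferInstance
  exact ⟨(singleObjHomologySelfIso (ComplexShape.up ℤ) (-1) B).symm ≪≫
    (asIso (homologyMap s (-1)) :) ≪≫ (asIso (L.homologyπ (-1))).symm⟩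

-- The complex `L` is exact in degree 0 and B is the kernel of L⁻¹ → L⁰. Pulling back L⁻¹ → Z⁰ along
-- `a` therefore gives an extension of A by B, and a section of it is the required lift of `a`.
open HomologicalComplex in
lemma exists_lift_of_quasiIso_singleFunctor {A B : K} {L : CochainComplex K ℤ}
    [L.IsStrictlyGE (-1)] (s : (CochainComplex.singleFunctor K (-1)).obj B ⟶ L) [QuasiIso s]
    (h : ∀ (E : K) (i : B ⟶ E) (p : E ⟶ A) (zero : i ≫ p = 0),
      (ShortComplex.mk i p zero).ShortExact → ∃ s : A ⟶ E, s ≫ p = 𝟙 A)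
    (a : A ⟶ L.X 0) (ha : a ≫ L.d 0 1 = 0) :
    ∃ b : A ⟶ L.X (-1), b ≫ L.d (-1) 0 = a := by
  obtain ⟨β⟩ := nonempty_iso_cycles_of_quasiIso_singleFunctor s
  have h₀ : L.ExactAt 0 := by
    rw [← exactAt_iff_of_quasiIsoAt s]
    exact exactAt_single_obj _ _ _ _ (by simp)
  have h₀' : Epi (L.toCycles (-1) 0) :=
    Preadditive.epi_of_isZero_cokernel' _ (L.homologyIsCokernel (-1) 0 (by simp))
      h₀.isZero_homology
  let a' : A ⟶ L.cycles 0 := L.liftCycles a 1 (by simp) ha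
  let k : B ⟶ pullback (L.toCycles (-1) 0) a' := pullback.lift (β.hom ≫ L.iCycles (-1)) 0 (by
    simp [← cancel_mono (L.iCycles 0)])
  have hk : k ≫ pullback.snd _ _ = 0 := pullback.lift_snd _ _ _
  have hk' : k ≫ pullback.fst _ _ = β.hom ≫ L.iCycles (-1) := pullback.lift_fst _ _ _
  have : Mono k := mono_of_mono_fac hk'
  have ex : (ShortComplex.mk k (pullback.snd _ _) hk).Exact := by
    refine ShortComplex.exact_of_f_is_kernel _ (KernelFork.IsLimit.ofι' _ _ fun {T} t ht => ?_)
    have ht' : (t ≫ pullback.fst _ _) ≫ L.d (-1) 0 = 0 := by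
      rw [← L.toCycles_i (-1) 0, Category.assoc, pullback.condition_assoc, reassoc_of% ht,
        zero_comp]
    refine ⟨L.liftCycles _ 0 (by simp) ht' ≫ β.inv, ?_⟩
    apply pullback.hom_ext
    · simp [hk']
    · simp [hk, ht]
  obtain ⟨t, ht⟩ := h _ k (pullback.snd _ _) hk { exact := ex }
  refine ⟨t ≫ pullback.fst _ _, ?_⟩
  rw [← L.toCycles_i (-1) 0, Category.assoc, pullback.condition_assoc, reassoc_of% ht]
  simp [a']

open CochainComplex.HomComplex DerivedCategory in
/-- If all extensions of `A` by `B` split, then `Ext¹(A, B) = 0`. -/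
lemma extOneVanishes_of_forall_exists_section {A B : K}
    (h : ∀ (E : K) (i : B ⟶ E) (p : E ⟶ A) (zero : i ≫ p = 0),
      (ShortComplex.mk i p zero).ShortExact → ∃ s : A ⟶ E, s ≫ p = 𝟙 A) :
    ExtOneVanishes A B := by
  let _ : HasExt.{max u v} K := HasExt.standard K
  let := HasDerivedCategory.standard K
  refine subsingleton_of_forall_eq (α := Ext.{max u v} A B 1) 0 fun e => ?_
  apply Ext.homEquiv.injective
  simp only [← cancel_mono (((singleFunctors K).shiftIso 1 (-1) 0 (by lia)).hom.app B),
    Ext.zero_hom, Limits.zero_comp]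
  generalize e.hom ≫ _ = φ
  change (Q.obj ((CochainComplex.singleFunctor K 0).obj A) ⟶
    Q.obj ((CochainComplex.singleFunctor K (-1)).obj B)) at φ
  -- A class in Ext¹ is a roof A → L ← B[1] whose second leg is a quasi-isomorphism, with L zero
  -- below degree -1. It suffices that `g` is null-homotopic, and a homotopy is exactly a lift of
  -- its degree 0 component to L⁻¹.
  obtain ⟨L, _, g, s, hs, rfl⟩ := left_fac_of_isStrictlyGE φ (-1)
  rw [isIso_Q_map_iff_quasiIso] at hs
  obtain ⟨a, ha⟩ := Cochain.fromSingleMk_surjective (Cochain.ofHom g) 0 (zero_add 0)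
  have ha' : a ≫ L.d 0 1 = 0 := by
    have := δ_ofHom g (p := 1)
    rw [← ha, Cochain.δ_fromSingleMk _ _ 1 1 (by simp)] at this
    simpa using congrArg (Cochain.fromSingleEquiv (zero_add 1)) this
  obtain ⟨b, hb⟩ := exists_lift_of_quasiIso_singleFunctor s h a ha'
  have H : Homotopy g 0 := (Cochain.equivHomotopy _ _).symm
    ⟨Cochain.fromSingleMk b (by simp), by
      rw [Cochain.δ_fromSingleMk _ _ 0 0 (by simp), hb, ha]; simp⟩
  rw [DerivedCategory.Q_map_eq_of_homotopy K H, Functor.map_zero]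
  exact Limits.zero_comp

end Ext

/-! ### Smooth chains without their target, compared with transfinite compositions. -/

section SmoothChains

variable {C : Type u} [Category.{v} C]

/-- The object `D` is, via the maps `q`, the colimit of the restriction of `G` to `s`. -/
def IsColimitOn {A : Type w} [Preorder A] (G : A ⥤ C) (s : Set A) {D : C}
    (q : ∀ a, a ∈ s → (G.obj a ⟶ D)) : Prop :=
  ∀ (T : C) (φ : ∀ a, a ∈ s → (G.obj a ⟶ T)),
    (∀ a b (ha : a ∈ s) (hb : b ∈ s) (h : a ≤ b), G.map (homOfLE h) ≫ φ b hb = φ a ha) →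
      ∃! ψ : D ⟶ T, ∀ a ha, q a ha ≫ ψ = φ a ha

namespace IsColimitOn

variable {A : Type w} [Preorder A] {G : A ⥤ C} {s : Set A} {D : C}
  {q : ∀ a, a ∈ s → (G.obj a ⟶ D)}

lemma comp_iso (h : IsColimitOn G s q) {D' : C} (e : D ⟶ D') [IsIso e] :
    IsColimitOn G s (fun a ha => q a ha ≫ e) := by
  intro T φ hφ
  obtain ⟨ψ, hψ, uniq⟩ := h T φ hφ
  refine ⟨inv e ≫ ψ, fun a ha => by simpa using hψ a ha, fun ψ' hψ' => ?_⟩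
  rw [← uniq (e ≫ ψ') (fun a ha => by simpa using hψ' a ha), IsIso.inv_hom_id_assoc]

lemma congr (h : IsColimitOn G s q) {s' : Set A} {q' : ∀ a, a ∈ s' → (G.obj a ⟶ D)}
    (hs : s = s') (hq : ∀ a ha ha', q a ha = q' a ha') : IsColimitOn G s' q' := by
  subst hs
  obtain rfl : q = q' := by
    ext a ha
    exact hq _ _ _
  exact h

end IsColimitOn

/-- A smooth chain of morphisms in `W` from `X` to `Z`, indexed by a nonempty well-ordered set `A`,
where `Z` is not a term of the chain: if `A` has a greatest element, the morphism
from the last term to `Z` has to be in `W`, and otherwise `Z` is the colimit of the chain. -/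
structure SmoothChain (W : MorphismProperty C) (A : Type w) [LinearOrder A]
    {X Z : C} (f : X ⟶ Z) where
  /-- the terms of the chain -/
  G : A ⥤ C
  /-- the maps from the source -/
  u (a : A) : X ⟶ G.obj a
  /-- the maps to the target -/
  v (a : A) : G.obj a ⟶ Z
  u_map {a b : A} (h : a ≤ b) : u a ≫ G.map (homOfLE h) = u b
  map_v {a b : A} (h : a ≤ b) : G.map (homOfLE h) ≫ v b = v a
  fac (a : A) : u a ≫ v a = f
  isIso_u (a : A) : IsMin a → IsIso (u a)
  step {a b : A} (h : a ⋖ b) : W (G.map (homOfLE h.le))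
  last (a : A) : IsMax a → W (v a)
  isColimit (a : A) : ¬ IsMin a → (∀ b, ¬ b ⋖ a) →
    IsColimitOn G (Set.Iio a) (fun _ hb => G.map (homOfLE (le_of_lt hb)))
  isColimit_top : (∀ a : A, ¬ IsMax a) → IsColimitOn G Set.univ (fun a _ => v a)

/-- The morphisms which are compositions of a smooth chain of morphisms in `W`. -/
def smoothChains (W : MorphismProperty C) : MorphismProperty C := fun _ _ f =>
  ∃ (A : Type w) (_ : LinearOrder A) (_ : WellFoundedLT A) (_ : Nonempty A),
    Nonempty (SmoothChain W A f)

lemma exists_covBy_of_not_isMax {A : Type w} [LinearOrder A] [WellFoundedLT A] {a : A}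
    (ha : ¬ IsMax a) : ∃ b, a ⋖ b := by
  let := SuccOrder.ofLinearWellFoundedLT A
  exact ⟨_, Order.covBy_succ_of_not_isMax ha⟩

lemma isSuccLimit_iff_forall_not_covBy {A : Type w} [LinearOrder A] {a : A} :
    Order.IsSuccLimit a ↔ ¬ IsMin a ∧ ∀ b, ¬ b ⋖ a := by
  rw [Order.isSuccLimit_iff, Order.IsSuccPrelimit]

/-! ### From smooth chains to transfinite compositions -/

section

variable {W : MorphismProperty C} {A : Type w} [LinearOrder A]
  {X Z : C} {f : X ⟶ Z} (c : SmoothChain W A f)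

namespace SmoothChain

/-- The terms of a smooth chain, including the target. -/
def withTopObj : WithTop A → C
  | none => Z
  | some a => c.G.obj a

/-- The transition maps of a smooth chain, including the target. -/
def withTopMap : ∀ (x y : WithTop A), x ≤ y → (c.withTopObj x ⟶ c.withTopObj y)
  | some _, some _, h => c.G.map (homOfLE (WithTop.coe_le_coe.1 h))
  | some a, none, _ => c.v a
  | none, none, _ => 𝟙 Z
  | none, some a, h => (WithTop.not_top_le_coe a h).elim

/-- A smooth chain, including the target, as a functor. -/
def withTop : WithTop A ⥤ C where
  obj := c.withTopObj
  map {x y} h := c.withTopMap x y (leOfHom h)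
  map_id := by
    rintro (_ | a)
    · rfl
    · exact c.G.map_id a
  map_comp := by
    rintro (_ | x) (_ | y) (_ | z) h h'
    · exact (Category.comp_id _).symm
    · exact (WithTop.not_top_le_coe _ (leOfHom h')).elim
    · exact (WithTop.not_top_le_coe _ (leOfHom h)).elim
    · exact (WithTop.not_top_le_coe _ (leOfHom h)).elim
    · exact (Category.comp_id _).symm
    · exact (WithTop.not_top_le_coe _ (leOfHom h')).elim
    · exact (c.map_v _).symm
    · exact c.G.map_comp (homOfLE (WithTop.coe_le_coe.1 (leOfHom h)))
        (homOfLE (WithTop.coe_le_coe.1 (leOfHom h')))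

end SmoothChain

/-- A colimit over `s` in the elementwise sense is a colimit, for a cocone over a category which is
equivalent to `s`. -/
noncomputable def IsColimitOn.isColimit {A' : Type w'} [Preorder A'] {G : A ⥤ C} {s : Set A} {D : C}
    {q : ∀ a, a ∈ s → (G.obj a ⟶ D)} (h : IsColimitOn G s q) {F : A' ⥤ C} (t : Cocone F)
    (e : ∀ a, a ∈ s → A') (he : ∀ a b ha hb, a ≤ b → e a ha ≤ e b hb)
    (he' : ∀ x, ∃ a ha, e a ha = x)
    (i : ∀ a ha, G.obj a ≅ F.obj (e a ha))
    (hi : ∀ a b ha hb (hab : a ≤ b), G.map (homOfLE hab) ≫ (i b hb).hom =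
      (i a ha).hom ≫ F.map (homOfLE (he a b ha hb hab)))
    (j : D ≅ t.pt) (hj : ∀ a ha, q a ha ≫ j.hom = (i a ha).hom ≫ t.ι.app (e a ha)) :
    IsColimit t :=
  have key (r : Cocone F) := h r.pt (fun a ha => (i a ha).hom ≫ r.ι.app (e a ha))
    (fun a b ha hb hab => by rw [reassoc_of% hi a b ha hb hab, r.w])
  { desc r := j.inv ≫ (key r).choose
    fac r x := by
      obtain ⟨a, ha, rfl⟩ := he' x
      rw [← cancel_epi (i a ha).hom, ← reassoc_of% hj a ha, Iso.hom_inv_id_assoc]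
      exact (key r).choose_spec.1 a ha
    uniq r m hm := by
      rw [Iso.eq_inv_comp]
      exact (key r).choose_spec.2 _ (fun a ha => by
        rw [reassoc_of% hj a ha, hm]) }

/-- Adjoining the target as a top term to the chain makes the colimit evaluation at `⊤`. The
conditions `last` and `isColimit_top` become the successor and limit conditions at `⊤`. -/
lemma SmoothChain.transfiniteCompositions [WellFoundedLT A] [Nonempty A]
    (c : SmoothChain W A f) : MorphismProperty.transfiniteCompositions.{w} W f := by
  let _ := WellFoundedLT.toOrderBot A
  let _ := SuccOrder.ofLinearWellFoundedLT (WithTop A)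
  rw [MorphismProperty.transfiniteCompositions_iff]
  have : IsIso (c.u ⊥) := c.isIso_u ⊥ isMin_bot
  refine ⟨WithTop A, inferInstance, inferInstance, inferInstance, inferInstance, ⟨{
    F := c.withTop
    isoBot := (asIso (c.u ⊥)).symm
    isWellOrderContinuous := ⟨?_⟩
    incl := { app x := c.withTop.map (homOfLE le_top)
              naturality x y h :=
                (c.withTop.map_comp h (homOfLE le_top)).symm.trans (Category.comp_id _).symm }
    isColimit :=
      { desc s := s.ι.app ⊤
        fac s x := s.w (homOfLE le_top)
        uniq s m hm := ((Category.id_comp m).symm.trans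
          (congrArg (· ≫ m) (c.withTop.map_id ⊤).symm)).trans (hm ⊤) }
    fac := c.fac ⊥
    map_mem := ?_ }⟩⟩
  · rintro (_ | a) hm
    · have : ∀ a : A, ¬ IsMax a := by
        intro a ha
        refine (isSuccLimit_iff_forall_not_covBy.1 hm).2 (a : WithTop A)
          ⟨WithTop.coe_lt_top a, ?_⟩
        rintro (_ | b) hb hb'
        · exact lt_irrefl _ hb'
        · exact ha.not_lt (WithTop.coe_lt_coe.1 hb)
      exact ⟨(c.isColimit_top this).isColimit _ (fun a _ => ⟨a, WithTop.coe_lt_top a⟩)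
        (fun a b _ _ h => WithTop.coe_le_coe.2 h) (by
          rintro ⟨(_ | a), ha⟩
          · exact (lt_irrefl (⊤ : WithTop A) ha).elim
          · exact ⟨a, trivial, rfl⟩) (fun _ _ => Iso.refl _)
        (fun a b ha hb h => (Category.comp_id _).trans (Category.id_comp _).symm) (Iso.refl _)
        (fun a ha => (Category.comp_id _).trans (Category.id_comp _).symm)⟩
    · obtain ⟨h₁, h₂⟩ := isSuccLimit_iff_forall_not_covBy.1 hm
      have h₁' : ¬ IsMin a := by
        intro ha
        refine h₁ ?_
        rintro (_ | b) hb
        · exact le_top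
        · exact WithTop.coe_le_coe.2 (ha (WithTop.coe_le_coe.1 hb))
      exact ⟨(c.isColimit a h₁' (fun b hb => h₂ b (WithTop.coe_covBy_coe.2 hb))).isColimit _
        (fun b hb => ⟨b, WithTop.coe_lt_coe.2 hb⟩)
        (fun a b _ _ h => WithTop.coe_le_coe.2 h) (by
          rintro ⟨(_ | b), hb⟩
          · exact (not_top_lt (show (⊤ : WithTop A) < _ from hb)).elim
          · exact ⟨b, WithTop.coe_lt_coe.1 hb, rfl⟩) (fun _ _ => Iso.refl _)
        (fun a b ha hb h => (Category.comp_id _).trans (Category.id_comp _).symm) (Iso.refl _)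
        (fun a ha => (Category.comp_id _).trans (Category.id_comp _).symm)⟩
  · intro x hx
    have hcov := Order.covBy_succ_of_not_isMax hx
    suffices ∀ y (h : x ⋖ y), W (c.withTop.map (homOfLE h.le)) from this _ hcov
    rintro y hxy
    match x, y, hxy with
    | none, y, hxy => exact (not_top_lt hxy.lt).elim
    | some a, none, hxy =>
      refine c.last a (fun b hb => ?_)
      by_contra! hb'
      exact hxy.2 (WithTop.coe_lt_coe.2 hb') (WithTop.coe_lt_top b)
    | some a, some b, hxy => exact c.step (WithTop.coe_covBy_coe.1 hxy)

end

lemma smoothChains_le_transfiniteCompositions (W : MorphismProperty C) :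
    smoothChains.{w} W ≤ MorphismProperty.transfiniteCompositions.{w} W := by
  rintro _ _ f ⟨A, _, _, _, ⟨c⟩⟩
  exact c.transfiniteCompositions

/-! ### From transfinite compositions to smooth chains -/

/-- A colimit cocone is a colimit in the elementwise sense. -/
lemma IsColimitOn.of_isColimit {A : Type w} [Preorder A] {G : A ⥤ C} {s : Set A}
    {A' : Type w'} [Preorder A'] {e : A' → A} {he : Monotone e} {t : Cocone (he.functor ⋙ G)}
    (ht : IsColimit t) (hes : ∀ x, e x ∈ s) (hes' : ∀ a ∈ s, ∃ x, e x = a)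
    {q : ∀ a, a ∈ s → (G.obj a ⟶ t.pt)} (hq : ∀ x, q (e x) (hes x) = t.ι.app x) :
    IsColimitOn G s q := by
  intro T φ hφ
  let r : Cocone (he.functor ⋙ G) := Cocone.mk T
    { app x := φ (e x) (hes x)
      naturality x y h := (hφ _ _ _ _ (he (leOfHom h))).trans (Category.comp_id _).symm }
  refine ⟨ht.desc r, fun a ha => ?_, fun ψ hψ => ht.hom_ext fun x => ?_⟩
  · obtain ⟨x, rfl⟩ := hes' a ha
    exact (congrArg (· ≫ ht.desc r) (hq x)).trans (ht.fac r x)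
  · exact (congrArg (· ≫ ψ) (hq x)).symm.trans ((hψ _ (hes x)).trans (ht.fac r x).symm)

section

variable {W : MorphismProperty C} {J : Type w} [LinearOrder J] [OrderBot J] [SuccOrder J]
  [WellFoundedLT J] {X Z : C} {f : X ⟶ Z} (c : W.TransfiniteCompositionOfShape J f)

namespace TransfiniteComposition

lemma map_incl {a b : J} (h : a ≤ b) : c.F.map (homOfLE h) ≫ c.incl.app b = c.incl.app a :=
  (c.incl.naturality (homOfLE h)).trans (Category.comp_id _)

lemma isIso_incl_of_isMax {m : J} (hm : IsMax m) : IsIso (c.incl.app m) :=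
  c.isColimit.isIso_ι_app_of_isTerminal _
    (IsTerminal.ofUniqueHom (fun x => homOfLE (hm.isTop x)) (fun _ _ => Subsingleton.elim _ _))

lemma map_mem_of_covBy {a b : J} (h : a ⋖ b) : W (c.F.map (homOfLE h.le)) := by
  suffices ∀ (y : J) (h : a ≤ y), y = Order.succ a → W (c.F.map (homOfLE h)) from
    this b h.le (Order.succ_eq_of_covBy h).symm
  rintro _ _ rfl
  exact c.map_mem a h.lt.not_isMax

lemma incl_mem_of_isMax_succ [W.RespectsIso] {a : J} (ha : ¬ IsMax a) (hm : IsMax (Order.succ a)) :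
    W (c.incl.app a) := by
  have := isIso_incl_of_isMax c hm
  rw [← map_incl c (Order.le_succ a), MorphismProperty.cancel_right_of_respectsIso (P := W)]
  exact c.map_mem a ha

lemma isColimitOn_Iio {m : J} (hm : Order.IsSuccLimit m) :
    IsColimitOn c.F (Set.Iio m) (fun _ h => c.F.map (homOfLE (le_of_lt h))) :=
  IsColimitOn.of_isColimit (A' := Set.Iio m) (e := Subtype.val) (he := fun _ _ h => h)
    (t := (Set.principalSegIio m).cocone c.F)
    (c.F.isColimitOfIsWellOrderContinuous m hm) (fun x => x.2)
    (fun b hb => ⟨⟨b, hb⟩, rfl⟩) (fun _ => rfl)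

lemma isColimitOn_univ : IsColimitOn c.F Set.univ (fun a _ => c.incl.app a) :=
  IsColimitOn.of_isColimit (A' := J) (e := id) (he := monotone_id)
    (t := Cocone.mk Z c.incl) c.isColimit (fun _ => Set.mem_univ _)
    (fun b _ => ⟨b, rfl⟩) (fun _ => rfl)

end TransfiniteComposition

/-- Elementwise colimits over a set of elements of a subtype. -/
lemma IsColimitOn.restrict {A : Type w} [Preorder A] {G : A ⥤ C} {p : A → Prop} {s : Set A}
    {D : C} {q : ∀ a, a ∈ s → (G.obj a ⟶ D)} (h : IsColimitOn G s q) (hs : ∀ a ∈ s, p a)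
    {s' : Set (Subtype p)} (hs' : ∀ a, a ∈ s' ↔ a.1 ∈ s) :
    IsColimitOn ((Subtype.mono_coe p).functor ⋙ G) s' (fun a ha => q a.1 ((hs' a).1 ha)) := by
  intro T φ hφ
  obtain ⟨ψ, h₁, h₂⟩ := h T (fun a ha => φ ⟨a, hs a ha⟩ ((hs' _).2 ha))
    (fun a b ha hb hab => hφ ⟨a, hs a ha⟩ ⟨b, hs b hb⟩ ((hs' _).2 ha) ((hs' _).2 hb) hab)
  exact ⟨ψ, fun a ha => h₁ a.1 ((hs' a).1 ha),
    fun ψ' hψ' => h₂ ψ' (fun a ha => hψ' ⟨a, hs a ha⟩ ((hs' _).2 ha))⟩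

open TransfiniteComposition in
/-- A transfinite composition, indexed by a set with at least two elements,
gives a smooth chain. -/
noncomputable def SmoothChain.ofTransfiniteComposition [W.RespectsIso]
    (hJ : ¬ IsMax (⊥ : J)) : SmoothChain W {j : J // ¬ IsMax j} f where
  G := (Subtype.mono_coe (fun j : J => ¬ IsMax j)).functor ⋙ c.F
  u a := c.isoBot.inv ≫ c.F.map (homOfLE bot_le : ⊥ ⟶ a.1)
  v a := c.incl.app a.1
  u_map {a b} h := (Category.assoc _ _ _).trans
    (congrArg (c.isoBot.inv ≫ ·) (c.F.map_comp _ _).symm)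
  map_v {a b} h := map_incl c h
  fac a := (Category.assoc _ _ _).trans
    ((congrArg (c.isoBot.inv ≫ ·) (map_incl c (bot_le : ⊥ ≤ a.1))).trans c.fac)
  isIso_u a ha := by
    obtain rfl : a = ⟨⊥, hJ⟩ := ha.eq_of_ge bot_le
    have : IsIso (c.F.map (homOfLE (bot_le : ⊥ ≤ (⊥ : J)))) :=
      inferInstanceAs (IsIso (c.F.map (𝟙 _)))
    exact (inferInstance : IsIso (c.isoBot.inv ≫ c.F.map (homOfLE (bot_le : ⊥ ≤ (⊥ : J)))))
  step {a b} h := map_mem_of_covBy c (a := a.1) (b := b.1)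
    ⟨h.lt, fun x hx hx' => h.2 (c := ⟨x, hx'.not_isMax⟩) hx hx'⟩
  last a ha := by
    refine incl_mem_of_isMax_succ c a.2 ?_
    by_contra hm
    exact ha.not_lt (b := ⟨_, hm⟩) (Order.lt_succ_of_not_isMax a.2)
  isColimit a h₁ h₂ := by
    have ha : Order.IsSuccLimit a.1 := by
      rw [isSuccLimit_iff_forall_not_covBy]
      refine ⟨fun h => h₁ (fun b hb => h hb), fun b hb => h₂ ⟨b, hb.lt.not_isMax⟩ ?_⟩
      exact ⟨hb.lt, fun x hx hx' => hb.2 hx hx'⟩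
    exact (isColimitOn_Iio c ha).restrict (fun b (hb : b < a.1) => hb.not_isMax)
      (fun a => Iff.rfl)
  isColimit_top h := by
    -- If J has a greatest element `m`, it is a limit, as the remaining indices have no maximum;
    -- continuity at `m` is then transported along F m ≅ Z.
    by_cases hm : ∃ m : J, IsMax m
    · obtain ⟨m, hm⟩ := hm
      have hlt (x : {j : J // ¬ IsMax j}) : x.1 < m :=
        lt_of_le_of_ne (hm.isTop x.1) (fun e => x.2 (e ▸ hm))
      have ha : Order.IsSuccLimit m := by
        rw [isSuccLimit_iff_forall_not_covBy]
        refine ⟨fun hm' => (hlt ⟨⊥, hJ⟩).not_ge (hm' bot_le), fun b hb => ?_⟩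
        exact h ⟨b, hb.lt.not_isMax⟩ (fun x hx => not_lt.1 (fun hx' => hb.2 hx' (hlt x)))
      have := isIso_incl_of_isMax c hm
      refine (((isColimitOn_Iio c ha).comp_iso (c.incl.app m)).restrict
        (p := fun j => ¬ IsMax j) (fun b (hb : b < m) => hb.not_isMax) (s' := Set.univ)
        (fun a => ⟨fun _ => hlt a, fun _ => trivial⟩)).congr rfl (fun a _ _ => ?_)
      exact map_incl c (hlt a).le
    · have hm' (j : J) : ¬ IsMax j := fun hj => hm ⟨j, hj⟩
      exact (isColimitOn_univ c).restrict (fun b _ => hm' b) (fun a => by simp)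

end

/-- The isomorphism case comes from a one-element index: there are no steps, so the composition is
vacuously one of isomorphisms, while deleting the maximum would leave an empty chain. -/
lemma smoothChains_or_isIso_of_transfiniteCompositions {W : MorphismProperty C} [W.RespectsIso]
    {X Z : C} {f : X ⟶ Z} (hf : MorphismProperty.transfiniteCompositions.{w} W f) :
    smoothChains.{w} W f ∨ IsIso f := by
  rw [MorphismProperty.transfiniteCompositions_iff] at hf
  obtain ⟨J, _, _, _, _, ⟨c⟩⟩ := hf
  by_cases hJ : IsMax (⊥ : J)
  · right
    let c' : (MorphismProperty.isomorphisms C).TransfiniteCompositionOfShape J f :=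
      { toTransfiniteCompositionOfShape := c.toTransfiniteCompositionOfShape
        map_mem j hj := by
          obtain rfl : j = ⊥ := hJ.eq_of_ge bot_le
          exact (hj hJ).elim }
    exact c'.isIso
  · have : Nonempty {j : J // ¬ IsMax j} := ⟨⟨⊥, hJ⟩⟩
    exact Or.inl ⟨_, inferInstance, inferInstance, this, ⟨.ofTransfiniteComposition c hJ⟩⟩

end SmoothChains

/-! ### Refining the steps of a chain: lexicographic concatenation. -/

section Lexicographic

variable {C : Type u} [Category.{v} C]

/-- The disjoint union of a family of ordered sets, with the lexicographic order. -/
@[ext]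
structure LexSigma {B : Type w} (A : B → Type w) where
  /-- the index of the summand -/
  fst : B
  /-- the element of the summand -/
  snd : A fst

namespace LexSigma

variable {B : Type w} [LinearOrder B] {A : B → Type w} [∀ j, LinearOrder (A j)]

noncomputable instance : LinearOrder (LexSigma A) :=
  LinearOrder.lift' (β := Σₗ j, A j) (fun x => toLex ⟨x.fst, x.snd⟩) (by
    rintro ⟨j, a⟩ ⟨k, b⟩ h
    cases h
    rfl)

lemma le_def {x y : LexSigma A} :
    x ≤ y ↔ x.fst < y.fst ∨ ∃ e : x.fst = y.fst, e ▸ x.snd ≤ y.snd := Sigma.Lex.le_def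

lemma lt_def {x y : LexSigma A} :
    x < y ↔ x.fst < y.fst ∨ ∃ e : x.fst = y.fst, e ▸ x.snd < y.snd := Sigma.Lex.lt_def

lemma mk_lt_mk_of_lt {j k : B} (h : j < k) (a : A j) (b : A k) :
    (⟨j, a⟩ : LexSigma A) < ⟨k, b⟩ := lt_def.2 (Or.inl h)

lemma mk_le_mk_of_le {j : B} {a b : A j} (h : a ≤ b) :
    (⟨j, a⟩ : LexSigma A) ≤ ⟨j, b⟩ := le_def.2 (Or.inr ⟨rfl, h⟩)

lemma mk_lt_mk {j : B} {a b : A j} :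
    (⟨j, a⟩ : LexSigma A) < ⟨j, b⟩ ↔ a < b := by
  simp [lt_def]

lemma lt_cases {j k : B} {a : A j} {b : A k} (h : (⟨j, a⟩ : LexSigma A) < ⟨k, b⟩) :
    j < k ∨ ∃ e : j = k, e ▸ a < b := lt_def.1 h

lemma le_cases {j k : B} {a : A j} {b : A k} (h : (⟨j, a⟩ : LexSigma A) ≤ ⟨k, b⟩) :
    j < k ∨ ∃ e : j = k, e ▸ a ≤ b := le_def.1 h

instance [WellFoundedLT B] [∀ j, WellFoundedLT (A j)] : WellFoundedLT (LexSigma A) where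
  wf := ⟨by
    suffices ∀ (j : B) (a : A j), Acc (· < ·) (⟨j, a⟩ : LexSigma A) from fun x => this x.1 x.2
    intro j
    induction j using WellFoundedLT.induction with
    | ind j hj =>
      intro a
      induction a using WellFoundedLT.induction with
      | ind a ha =>
        refine ⟨_, ?_⟩
        rintro ⟨k, b⟩ h
        obtain hkj | ⟨rfl, hab⟩ := lt_cases h
        · exact hj k hkj b
        · exact ha b hab⟩

instance [Nonempty B] [∀ j, Nonempty (A j)] : Nonempty (LexSigma A) :=
  ⟨⟨Classical.arbitrary B, Classical.arbitrary _⟩⟩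

end LexSigma

/-- A functor `F` on `B` whose transition maps from each index `j` to the later ones factor
through `F j ⟶ N j`, together with a refinement `G j` of `F j ⟶ N j`. -/
structure LexData (C : Type u) [Category.{v} C] {B : Type w} [LinearOrder B]
    (A : B → Type w) [∀ j, LinearOrder (A j)] where
  F : B ⥤ C
  N : B → C
  n (j : B) : F.obj j ⟶ N j
  t {j k : B} (h : j < k) : N j ⟶ F.obj k
  n_t {j k : B} (h : j < k) : n j ≫ t h = F.map (homOfLE h.le)
  t_map {j k l : B} (h : j < k) (h' : k ≤ l) :
    t h ≫ F.map (homOfLE h') = t (lt_of_lt_of_le h h')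
  G (j : B) : A j ⥤ C
  u (j : B) (a : A j) : F.obj j ⟶ (G j).obj a
  v (j : B) (a : A j) : (G j).obj a ⟶ N j
  u_map (j : B) {a b : A j} (h : a ≤ b) : u j a ≫ (G j).map (homOfLE h) = u j b
  map_v (j : B) {a b : A j} (h : a ≤ b) : (G j).map (homOfLE h) ≫ v j b = v j a
  fac (j : B) (a : A j) : u j a ≫ v j a = n j

namespace LexData

variable {B : Type w} [LinearOrder B] {A : B → Type w} [∀ j, LinearOrder (A j)]
  (D : LexData C A)

lemma t_u_v_t {j k l : B} (h : j < k) (b : A k) (h' : k < l) :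
    D.t h ≫ D.u k b ≫ D.v k b ≫ D.t h' = D.t (h.trans h') := by
  rw [reassoc_of% D.fac k b, D.n_t, D.t_map]

/-- The transition maps inside of a fiber. -/
def fiberMap {j : B} {a : A j} {k : B} {b : A k} (e : j = k) (h : e ▸ a ≤ b) :
    (D.G j).obj a ⟶ (D.G k).obj b :=
  match k, b, e, h with
  | _, _, rfl, h => (D.G j).map (homOfLE h)

open Classical in
/-- The transition maps of the lexicographic refinement. -/
noncomputable def lexMap {x y : LexSigma A} (h : x ≤ y) :
    (D.G x.1).obj x.2 ⟶ (D.G y.1).obj y.2 :=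
  if hlt : x.1 < y.1 then D.v x.1 x.2 ≫ D.t hlt ≫ D.u y.1 y.2
  else D.fiberMap ((LexSigma.le_def.1 h).resolve_left hlt).choose
    ((LexSigma.le_def.1 h).resolve_left hlt).choose_spec

lemma lexMap_of_lt {j k : B} (hjk : j < k) (a : A j) (b : A k)
    (h : (⟨j, a⟩ : LexSigma A) ≤ ⟨k, b⟩) :
    D.lexMap h = D.v j a ≫ D.t hjk ≫ D.u k b := dif_pos hjk

lemma lexMap_of_le {j : B} {a b : A j} (hab : a ≤ b)
    (h : (⟨j, a⟩ : LexSigma A) ≤ ⟨j, b⟩) :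
    D.lexMap h = (D.G j).map (homOfLE hab) := dif_neg (lt_irrefl j)

lemma lexMap_comp {x y z : LexSigma A} (h : x ≤ y) (h' : y ≤ z) :
    D.lexMap h ≫ D.lexMap h' = D.lexMap (h.trans h') := by
  obtain ⟨j, a⟩ := x
  obtain ⟨k, b⟩ := y
  obtain ⟨l, c⟩ := z
  obtain hjk | ⟨rfl, hab⟩ := LexSigma.le_cases h <;> obtain hkl | ⟨rfl, hbc⟩ := LexSigma.le_cases h'
  · rw [D.lexMap_of_lt hjk, D.lexMap_of_lt hkl, D.lexMap_of_lt (hjk.trans hkl)]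
    simp only [Category.assoc, reassoc_of% D.t_u_v_t hjk b hkl]
  · dsimp only at hbc
    rw [D.lexMap_of_lt hjk, D.lexMap_of_le hbc, D.lexMap_of_lt hjk]
    simp only [Category.assoc, D.u_map]
  · dsimp only at hab
    rw [D.lexMap_of_le hab, D.lexMap_of_lt hkl, D.lexMap_of_lt hkl, reassoc_of% D.map_v j hab]
  · dsimp only at hab hbc
    rw [D.lexMap_of_le hab, D.lexMap_of_le hbc, D.lexMap_of_le (hab.trans hbc),
      ← Functor.map_comp, homOfLE_comp]

/-- The lexicographic refinement of `F` by the `G j`. -/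
@[reducible]
noncomputable def H : LexSigma A ⥤ C where
  obj x := (D.G x.1).obj x.2
  map h := D.lexMap (leOfHom h)
  map_id x := (D.lexMap_of_le (le_refl x.2) _).trans (CategoryTheory.Functor.map_id _ _)
  map_comp _ _ := (D.lexMap_comp _ _).symm

lemma H_map_of_lt {j k : B} (hjk : j < k) (a : A j) (b : A k)
    (h : (⟨j, a⟩ : LexSigma A) ≤ ⟨k, b⟩) :
    D.H.map (homOfLE h) = D.v j a ≫ D.t hjk ≫ D.u k b := D.lexMap_of_lt hjk a b h

lemma H_map_of_le {j : B} {a b : A j} (hab : a ≤ b)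
    (h : (⟨j, a⟩ : LexSigma A) ≤ ⟨j, b⟩) :
    D.H.map (homOfLE h) = (D.G j).map (homOfLE hab) := D.lexMap_of_le hab h

/-- Since `b` is not the first element of its fiber, the elements below it in that fiber are cofinal
among all indices below ⟨k, b⟩. -/
lemma isColimitOn_fiber {k : B} {b : A k} (hb : ¬ IsMin b)
    (h : IsColimitOn (D.G k) (Set.Iio b) (fun _ hb => (D.G k).map (homOfLE (le_of_lt hb)))) :
    IsColimitOn D.H (Set.Iio ⟨k, b⟩) (fun _ hb => D.H.map (homOfLE (le_of_lt hb))) := by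
  intro T φ hφ
  have hφ' (a a' : A k) (ha : a < b) (ha' : a' < b) (h : a ≤ a') :
      (D.G k).map (homOfLE h) ≫ φ ⟨k, a'⟩ (LexSigma.mk_lt_mk.2 ha') =
        φ ⟨k, a⟩ (LexSigma.mk_lt_mk.2 ha) :=
    (congrArg (· ≫ φ ⟨k, a'⟩ (LexSigma.mk_lt_mk.2 ha'))
      (D.H_map_of_le h (LexSigma.mk_le_mk_of_le h))).symm.trans (hφ ⟨k, a⟩ ⟨k, a'⟩ _ _ _)
  obtain ⟨ψ, h₁, h₂⟩ := h T (fun a ha => φ ⟨k, a⟩ (LexSigma.mk_lt_mk.2 ha)) hφ'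
  obtain ⟨b', hb'⟩ := not_isMin_iff.1 hb
  have h₁' (a : A k) (ha : a < b) : D.H.map (homOfLE (LexSigma.mk_le_mk_of_le ha.le)) ≫ ψ =
      φ ⟨k, a⟩ (LexSigma.mk_lt_mk.2 ha) :=
    (congrArg (· ≫ ψ) (D.H_map_of_le ha.le _)).trans (h₁ a ha)
  refine ⟨ψ, ?_, fun ψ' hψ' => h₂ ψ' fun a (ha : a < b) => ?_⟩
  · rintro ⟨j, a⟩ ha
    obtain hj | ⟨rfl, ha'⟩ := LexSigma.lt_cases ha
    · have h₃ := D.lexMap_comp (LexSigma.mk_lt_mk_of_lt hj a b').le (LexSigma.mk_le_mk_of_le hb'.le)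
      refine (congrArg (· ≫ ψ) h₃).symm.trans ((Category.assoc _ _ _).trans ?_)
      exact (congrArg (D.H.map (homOfLE (LexSigma.mk_lt_mk_of_lt hj a b').le) ≫ ·)
        (h₁' b' hb')).trans (hφ _ _ _ _ _)
    · exact h₁' a ha'
  · exact (congrArg (· ≫ ψ') (D.H_map_of_le ha.le _)).symm.trans
      (hψ' ⟨k, a⟩ (LexSigma.mk_lt_mk.2 ha))

variable {s : Set B} {P : C} (p : ∀ j, j ∈ s → (D.N j ⟶ P))

/-- The two diagrams interleave through F j → G j a → N j → F k for j < k, so they have the same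
cocones. -/
lemma isColimitOn_of_noMax [∀ j, Nonempty (A j)] (hs : ∀ j ∈ s, ∃ k ∈ s, j < k)
    (hp : ∀ j k (hj : j ∈ s) (hk : k ∈ s) (h : j < k), D.t h ≫ D.n k ≫ p k hk = p j hj)
    (h : IsColimitOn D.F s (fun j hj => D.n j ≫ p j hj)) :
    IsColimitOn D.H {x | x.fst ∈ s} (fun x hx => D.v x.1 x.2 ≫ p x.1 hx) := by
  intro T φ hφ
  have h₁ (j : B) (hj : j ∈ s) (a b : A j) (hab : a ≤ b) :
      D.u j a ≫ φ ⟨j, a⟩ hj = D.u j b ≫ φ ⟨j, b⟩ hj := by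
    rw [← D.u_map j hab, Category.assoc]
    refine congrArg (D.u j a ≫ ·) ?_
    exact (hφ ⟨j, a⟩ ⟨j, b⟩ hj hj (LexSigma.mk_le_mk_of_le hab)).symm.trans
      (congrArg (· ≫ φ ⟨j, b⟩ hj) (D.H_map_of_le hab _))
  have h₁' (j : B) (hj : j ∈ s) (a b : A j) :
      D.u j a ≫ φ ⟨j, a⟩ hj = D.u j b ≫ φ ⟨j, b⟩ hj :=
    (le_total a b).elim (h₁ j hj a b) (fun h => (h₁ j hj b a h).symm)
  have h₂ (j k : B) (hj : j ∈ s) (hk : k ∈ s) (hjk : j < k) (a : A j) (b : A k) :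
      D.v j a ≫ D.t hjk ≫ D.u k b ≫ φ ⟨k, b⟩ hk = φ ⟨j, a⟩ hj := by
    have := hφ ⟨j, a⟩ ⟨k, b⟩ hj hk (LexSigma.mk_lt_mk_of_lt hjk a b).le
    rw [← this]
    refine Eq.trans ?_ (congrArg (· ≫ φ ⟨k, b⟩ hk) (D.H_map_of_lt hjk a b _)).symm
    simp only [Category.assoc]
  obtain ⟨ψ, h₃, h₄⟩ := h T (fun j hj => D.u j (Classical.arbitrary _) ≫ φ ⟨j, _⟩ hj) (by
    intro j k hj hk hjk
    obtain rfl | hjk' := hjk.eq_or_lt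
    · exact (congrArg (· ≫ _) (D.F.map_id j)).trans (Category.id_comp _)
    · have a := Classical.arbitrary (A j)
      rw [h₁' j hj _ a, ← h₂ j k hj hk hjk' a (Classical.arbitrary _), ← D.n_t hjk', ← D.fac j a]
      simp only [Category.assoc])
  refine ⟨ψ, ?_, fun ψ' hψ' => h₄ ψ' fun j hj => ?_⟩
  · rintro ⟨j, a⟩ (hj : j ∈ s)
    obtain ⟨k, hk, hjk⟩ := hs j hj
    have := h₃ k hk
    dsimp only at this ⊢
    rw [← hp j k hj hk hjk, Category.assoc, Category.assoc, this, h₂]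
  · have := hψ' ⟨j, Classical.arbitrary _⟩ hj
    dsimp only at this ⊢
    rw [← this, ← D.fac j (Classical.arbitrary _)]
    simp only [Category.assoc]

/-- Here the last fiber is cofinal, and its colimit N j is identified with P. -/
lemma isColimitOn_of_isMax {j : B} (hj : j ∈ s) (hs : ∀ k ∈ s, k ≤ j) [Nonempty (A j)]
    (hp : ∀ j k (hj : j ∈ s) (hk : k ∈ s) (h : j < k), D.t h ≫ D.n k ≫ p k hk = p j hj)
    [IsIso (p j hj)] (h : IsColimitOn (D.G j) Set.univ (fun a _ => D.v j a)) :
    IsColimitOn D.H {x | x.fst ∈ s} (fun x hx => D.v x.1 x.2 ≫ p x.1 hx) := by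
  intro T φ hφ
  obtain ⟨ψ, h₃, h₄⟩ := h T (fun a _ => φ ⟨j, a⟩ hj) (fun a b _ _ hab =>
    (congrArg (· ≫ φ ⟨j, b⟩ hj) (D.H_map_of_le hab (LexSigma.mk_le_mk_of_le hab))).symm.trans
      (hφ ⟨j, a⟩ ⟨j, b⟩ hj hj _))
  refine ⟨inv (p j hj) ≫ ψ, ?_, fun ψ' hψ' => ?_⟩
  · rintro ⟨k, a⟩ (hk : k ∈ s)
    obtain rfl | hkj := (hs k hk).eq_or_lt
    · simpa using h₃ a trivial
    · let b := Classical.arbitrary (A j)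
      have h₅ := h₃ b trivial
      dsimp only at h₅ ⊢
      rw [← hp k j hk hj hkj]
      simp only [Category.assoc, IsIso.hom_inv_id_assoc]
      rw [← D.fac j b, Category.assoc, h₅,
        ← hφ ⟨k, a⟩ ⟨j, b⟩ hk hj (LexSigma.mk_lt_mk_of_lt hkj a b).le]
      refine Eq.trans ?_ (congrArg (· ≫ φ ⟨j, b⟩ hj) (D.H_map_of_lt hkj a b _)).symm
      simp only [Category.assoc]
  · rw [IsIso.eq_inv_comp]
    exact h₄ _ (fun a _ => (Category.assoc _ _ _).symm.trans (hψ' ⟨j, a⟩ hj))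

end LexData
/-- The factorization of the maps out of a term of a smooth chain through the next term. -/
lemma SmoothChain.exists_next {W : MorphismProperty C} {B : Type w} [LinearOrder B]
    [WellFoundedLT B] {X Z : C} {f : X ⟶ Z} (c : SmoothChain W B f) (j : B) :
    ∃ (N : C) (n : c.G.obj j ⟶ N) (t : ∀ k, j < k → (N ⟶ c.G.obj k)) (τ : N ⟶ Z),
      W n ∧ (∀ k (h : j < k), n ≫ t k h = c.G.map (homOfLE h.le)) ∧
      (∀ k l (h : j < k) (h' : k ≤ l),
        t k h ≫ c.G.map (homOfLE h') = t l (lt_of_lt_of_le h h')) ∧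
      (∀ k h, t k h ≫ c.v k = τ) ∧ n ≫ τ = c.v j ∧ (∀ k (h : j ⋖ k), IsIso (t k h.lt)) ∧
      (IsMax j → IsIso τ) := by
  by_cases hj : IsMax j
  · exact ⟨Z, c.v j, fun k h => (hj.not_lt h).elim, 𝟙 Z, c.last j hj,
      fun k h => (hj.not_lt h).elim, fun k l h => (hj.not_lt h).elim,
      fun k h => (hj.not_lt h).elim, Category.comp_id _, fun k h => (hj.not_lt h.lt).elim,
      fun _ => inferInstance⟩
  · obtain ⟨m, hm⟩ := exists_covBy_of_not_isMax hj
    have h₁ {k : B} (h : j < k) : m ≤ k := not_lt.1 (hm.2 h)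
    refine ⟨c.G.obj m, c.G.map (homOfLE hm.le), fun k h => c.G.map (homOfLE (h₁ h)), c.v m,
      c.step hm, fun k h => (c.G.map_comp _ _).symm, fun k l h h' => (c.G.map_comp _ _).symm,
      fun k h => c.map_v _, c.map_v _, fun k h => ?_, fun h => (hj h).elim⟩
    obtain rfl := hm.unique_right h
    exact inferInstanceAs (IsIso (c.G.map (𝟙 _)))

lemma LexSigma.not_isMax_of_covBy {B : Type w} [LinearOrder B] {A : B → Type w}
    [∀ j, LinearOrder (A j)] {k : B} {b : A k} (hb : IsMin b)
    (h : ∀ x : LexSigma A, ¬ x ⋖ ⟨k, b⟩) {j : B} (hj : j ⋖ k) (a : A j) : ¬ IsMax a := by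
  intro ha
  refine h ⟨j, a⟩ ⟨mk_lt_mk_of_lt hj.lt a b, ?_⟩
  rintro ⟨l, x⟩ h₁ h₂
  obtain h₁ | ⟨rfl, h₁⟩ := lt_cases h₁ <;> obtain h₂ | ⟨rfl, h₂⟩ := lt_cases h₂
  · exact hj.2 h₁ h₂
  · exact hb.not_lt h₂
  · exact ha.not_lt h₁
  · exact hb.not_lt h₂

lemma LexSigma.isMax_fst {B : Type w} [LinearOrder B] {A : B → Type w}
    [∀ j, LinearOrder (A j)] [∀ j, Nonempty (A j)] {j : B} {a : A j}
    (h : IsMax (⟨j, a⟩ : LexSigma A)) : IsMax j := by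
  intro k hk
  by_contra! hk'
  exact h.not_lt (mk_lt_mk_of_lt hk' a (Classical.arbitrary _))

lemma smoothChains_smoothChains_le (W : MorphismProperty C) [W.RespectsIso] :
    smoothChains.{w} (smoothChains.{w} W) ≤ smoothChains.{w} W := by
  rintro X Z f ⟨B, _, _, _, ⟨c⟩⟩
  choose N n t τ hn n_t t_map t_v n_τ ht hτ using c.exists_next
  choose A _ _ _ d using hn
  replace d (j : B) := (d j).some
  have t_n_τ (j k : B) (h : j < k) : t j k h ≫ n k ≫ τ k = τ j := by rw [n_τ, t_v]
  let D : LexData C A :=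
    { F := c.G
      N := N
      n := n
      t := t _ _
      n_t := n_t _ _
      t_map := t_map _ _ _
      G j := (d j).G
      u j := (d j).u
      v j := (d j).v
      u_map j _ _ := (d j).u_map
      map_v j _ _ := (d j).map_v
      fac j := (d j).fac }
  have map_of_le (j : B) (a b : A j) (h : a ≤ b) (h' : (⟨j, a⟩ : LexSigma A) ≤ ⟨j, b⟩) :
    D.H.map (homOfLE h') = (d j).G.map (homOfLE h) := D.H_map_of_le h h'
  have map_of_lt (j k : B) (h : j < k) (a : A j) (b : A k) (h' : (⟨j, a⟩ : LexSigma A) ≤ ⟨k, b⟩) :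
    D.H.map (homOfLE h') = (d j).v a ≫ t j k h ≫ (d k).u b := D.H_map_of_lt h a b h'
  refine ⟨LexSigma A, inferInstance, inferInstance, inferInstance, ⟨{
    G := D.H
    u x := c.u x.1 ≫ (d x.1).u x.2
    v x := (d x.1).v x.2 ≫ τ x.1
    u_map := ?_
    map_v := ?_
    fac x := ?_
    isIso_u := ?_
    step := ?_
    last := ?_
    isColimit := ?_
    isColimit_top := ?_ }⟩⟩
  · rintro ⟨j, a⟩ ⟨k, b⟩ h
    obtain h' | ⟨rfl, h'⟩ := LexSigma.le_cases h
    · rw [map_of_lt j k h', Category.assoc, reassoc_of% (d j).fac a, reassoc_of% n_t,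
        reassoc_of% c.u_map h'.le]
    · rw [map_of_le j a b h', Category.assoc, (d j).u_map h']
  · rintro ⟨j, a⟩ ⟨k, b⟩ h
    obtain h' | ⟨rfl, h'⟩ := LexSigma.le_cases h
    · rw [map_of_lt j k h']
      simp only [Category.assoc]
      rw [reassoc_of% (d k).fac b, t_n_τ]
    · rw [map_of_le j a b h', reassoc_of% (d j).map_v h']
  · rw [Category.assoc, reassoc_of% (d x.1).fac x.2, n_τ, c.fac]
  · rintro ⟨j, a⟩ h
    have : IsIso (c.u j) := c.isIso_u j (fun k hk => by
      by_contra! hk'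
      exact h.not_lt (LexSigma.mk_lt_mk_of_lt hk' (Classical.arbitrary _) a))
    have : IsIso ((d j).u a) := (d j).isIso_u a (fun b hb => by
      by_contra! hb'
      exact h.not_lt (LexSigma.mk_lt_mk.2 hb'))
    dsimp only
    infer_instance
  · rintro ⟨j, a⟩ ⟨k, b⟩ h
    obtain h' | ⟨rfl, h'⟩ := LexSigma.lt_cases h.lt
    -- A covering pair in different fibers consists of the last element of one and the first of the
    -- next; the map is the last step of chain `j` followed by isomorphisms.
    · have hjk : j ⋖ k := ⟨h', fun l hl hl' => h.2 (c := ⟨l, Classical.arbitrary _⟩)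
        (LexSigma.mk_lt_mk_of_lt hl _ _) (LexSigma.mk_lt_mk_of_lt hl' _ _)⟩
      have ha : IsMax a := fun a' ha' => by
        by_contra! ha''
        exact h.2 (LexSigma.mk_lt_mk.2 ha'') (LexSigma.mk_lt_mk_of_lt h' _ _)
      have hb : IsMin b := fun b' hb' => by
        by_contra! hb''
        exact h.2 (LexSigma.mk_lt_mk_of_lt h' _ _) (LexSigma.mk_lt_mk.2 hb'')
      have := ht j k hjk
      have := (d k).isIso_u b hb
      rw [map_of_lt j k h', MorphismProperty.cancel_right_of_respectsIso (P := W)]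
      exact (d j).last a ha
    · rw [map_of_le j a b h'.le]
      exact (d j).step ⟨h', fun x hx hx' => h.2 (LexSigma.mk_lt_mk.2 hx) (LexSigma.mk_lt_mk.2 hx')⟩
  · rintro ⟨j, a⟩ h
    have := hτ j (LexSigma.isMax_fst h)
    rw [MorphismProperty.cancel_right_of_respectsIso (P := W)]
    refine (d j).last a (fun b hb => ?_)
    by_contra! hb'
    exact h.not_lt (LexSigma.mk_lt_mk.2 hb')
  · rintro ⟨k, b⟩ h₁ h₂
    -- At the first element of fiber `k` the term is `c.G.obj k` up to isomorphism, and exactly the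
    -- earlier fibers lie below it.
    by_cases hb : IsMin b
    · have hs : {x : LexSigma A | x.fst ∈ Set.Iio k} = Set.Iio ⟨k, b⟩ := by
        ext ⟨j, a⟩
        refine ⟨fun (h : j < k) => LexSigma.mk_lt_mk_of_lt h a b, fun h => ?_⟩
        obtain h | ⟨rfl, h⟩ := LexSigma.lt_cases h
        · exact h
        · exact (hb.not_lt h).elim
      have hk : ¬ IsMin k := by
        intro hk
        refine h₁ ?_
        rintro ⟨j, a⟩ h
        obtain h | ⟨rfl, h⟩ := LexSigma.le_cases h
        · exact (hk.not_lt h).elim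
        · exact LexSigma.mk_le_mk_of_le (hb h)
      have := (d k).isIso_u b hb
      suffices IsColimitOn D.H {x | x.fst ∈ Set.Iio k} (fun x hx => D.v x.1 x.2 ≫ t x.1 k hx) from
        (this.comp_iso ((d k).u b)).congr hs (fun ⟨j, a⟩ ha ha' => by
          have := map_of_lt j k ha a b (le_of_lt ha')
          refine Eq.trans ?_ this.symm
          exact Category.assoc _ _ _)
      have hp (j l : B) (hj : j < k) (hl : l < k) (h : j < l) :
          t j l h ≫ n l ≫ t l k hl = t j k hj := by
        rw [n_t, t_map]
      -- If `k` covers `j`, the fiber over `j` has no greatest element and computes the colimit;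
      -- otherwise `k` is a limit and continuity of `c` applies.
      by_cases hk' : ∃ j, j ⋖ k
      · obtain ⟨j, hj⟩ := hk'
        have := ht j k hj
        exact D.isColimitOn_of_isMax (fun j hj => t j k hj) (j := j) hj.lt
          (fun l hl => not_lt.1 (fun h => hj.2 h hl)) hp
          ((d j).isColimit_top (LexSigma.not_isMax_of_covBy hb h₂ hj))
      · push Not at hk'
        refine D.isColimitOn_of_noMax (fun j hj => t j k hj)
          (fun j hj => ?_) hp ((c.isColimit k hk hk').congr rfl fun j _ _ => (n_t j k _).symm)
        by_contra! h
        exact hk' j ⟨hj, fun l hl hl' => (h l hl').not_gt hl⟩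
    · exact D.isColimitOn_fiber hb ((d k).isColimit b hb (fun b' hb' => h₂ ⟨k, b'⟩
        ⟨LexSigma.mk_lt_mk.2 hb'.lt, by
          rintro ⟨j, x⟩ h h'
          obtain h | ⟨rfl, h⟩ := LexSigma.lt_cases h <;> obtain h' | ⟨e, h'⟩ := LexSigma.lt_cases h'
          · exact lt_asymm h h'
          · subst e
            exact lt_irrefl _ h
          · exact lt_irrefl _ h'
          · exact hb'.2 h h'⟩))
  · intro h
    suffices IsColimitOn D.H {x | x.fst ∈ Set.univ} (fun x _ => D.v x.1 x.2 ≫ τ x.1) from this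
    by_cases hB : ∃ j : B, IsMax j
    · obtain ⟨j, hj⟩ := hB
      have := hτ j hj
      refine D.isColimitOn_of_isMax (fun j _ => τ j) (j := j) trivial
        (fun k _ => hj.isTop k) (fun j k _ _ => t_n_τ j k)
        ((d j).isColimit_top (fun a ha => h ⟨j, a⟩ ?_))
      rintro ⟨k, b⟩ h'
      obtain h' | ⟨rfl, h'⟩ := LexSigma.le_cases h'
      · exact (hj.not_lt h').elim
      · exact LexSigma.mk_le_mk_of_le (ha h')
    · push Not at hB
      exact D.isColimitOn_of_noMax (fun j _ => τ j)
        (fun j _ => (not_isMax_iff.1 (hB j)).imp fun k hk => ⟨trivial, hk⟩)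
        (fun j k _ _ => t_n_τ j k)
        ((c.isColimit_top hB).congr rfl fun j _ _ => (n_τ j).symm)

end Lexicographic

/-! ### Closure properties of smooth chains and transfinite compositions. -/

section

variable {C : Type u} [Category.{v} C]

/-- A smooth chain may be precomposed and postcomposed with isomorphisms. -/
def SmoothChain.compIso {W : MorphismProperty C} [W.RespectsIso] {A : Type w} [LinearOrder A]
    {X Z : C} {f : X ⟶ Z} (c : SmoothChain W A f) {X' Z' : C} (e : X' ⟶ X) [IsIso e]
    (g : Z ⟶ Z') [IsIso g] : SmoothChain W A (e ≫ f ≫ g) where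
  G := c.G
  u a := e ≫ c.u a
  v a := c.v a ≫ g
  u_map h := by rw [Category.assoc, c.u_map h]
  map_v h := by rw [reassoc_of% c.map_v h]
  fac a := by rw [Category.assoc, reassoc_of% c.fac a]
  isIso_u a ha := by
    have := c.isIso_u a ha
    infer_instance
  step := c.step
  last a ha := by
    rw [MorphismProperty.cancel_right_of_respectsIso (P := W)]
    exact c.last a ha
  isColimit := c.isColimit
  isColimit_top h := (c.isColimit_top h).comp_iso g

instance (W : MorphismProperty C) [W.RespectsIso] : (smoothChains.{w} W).RespectsIso :=
  MorphismProperty.RespectsIso.mk _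
    (fun e f ⟨A, _, _, _, ⟨c⟩⟩ => ⟨A, inferInstance, inferInstance, inferInstance,
      ⟨by simpa using c.compIso e.hom (𝟙 _)⟩⟩)
    (fun e f ⟨A, _, _, _, ⟨c⟩⟩ => ⟨A, inferInstance, inferInstance, inferInstance,
      ⟨by simpa using c.compIso (𝟙 _) e.hom⟩⟩)

instance (W : MorphismProperty C) :
    (MorphismProperty.transfiniteCompositions.{w} W).RespectsIso :=
  MorphismProperty.RespectsIso.of_respects_arrow_iso _ (fun f g e hf => by
    rw [MorphismProperty.transfiniteCompositions_iff] at hf ⊢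
    obtain ⟨J, _, _, _, _, ⟨c⟩⟩ := hf
    exact ⟨J, _, _, _, _, ⟨c.ofArrowIso e⟩⟩)

lemma transfiniteCompositions_of_isIso (W : MorphismProperty C) {X Y : C} (f : X ⟶ Y) [IsIso f] :
    MorphismProperty.transfiniteCompositions.{w} W f := by
  rw [← Category.id_comp f, MorphismProperty.cancel_right_of_respectsIso
    (P := MorphismProperty.transfiniteCompositions.{w} W)]
  exact MorphismProperty.transfiniteCompositionsOfShape_le_transfiniteCompositions _ _ _
    (MorphismProperty.TransfiniteCompositionOfShape.ofOrderIso (.id W X)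
      (orderIsoShrink.{w} (Fin 1)).symm).mem

lemma transfiniteCompositions_smoothChains_le (W : MorphismProperty C) [W.RespectsIso] :
    MorphismProperty.transfiniteCompositions.{w} (smoothChains.{w} W) ≤
      MorphismProperty.transfiniteCompositions.{w} W := by
  intro X Z f hf
  obtain hf | hf := smoothChains_or_isIso_of_transfiniteCompositions hf
  · exact smoothChains_le_transfiniteCompositions W _ (smoothChains_smoothChains_le W _ hf)
  · exact transfiniteCompositions_of_isIso W f

lemma transfiniteCompositions_comp {W : MorphismProperty C} [W.RespectsIso] {X Y Z : C}
    {f : X ⟶ Y} {g : Y ⟶ Z} (hf : MorphismProperty.transfiniteCompositions.{w} W f)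
    (hg : MorphismProperty.transfiniteCompositions.{w} W g) :
    MorphismProperty.transfiniteCompositions.{w} W (f ≫ g) := by
  obtain hf' | hf' := smoothChains_or_isIso_of_transfiniteCompositions hf
  · obtain hg' | hg' := smoothChains_or_isIso_of_transfiniteCompositions hg
    · exact transfiniteCompositions_smoothChains_le W _
        (MorphismProperty.transfiniteCompositionsOfShape_le_transfiniteCompositions _ _ _
          (MorphismProperty.TransfiniteCompositionOfShape.ofOrderIso
            (.ofComp f g hf' hg') (orderIsoShrink.{w} (Fin 3)).symm).mem)
    · exact (MorphismProperty.cancel_right_of_respectsIso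
        (MorphismProperty.transfiniteCompositions.{w} W) f g).2 hf
  · exact (MorphismProperty.cancel_left_of_respectsIso
      (MorphismProperty.transfiniteCompositions.{w} W) f g).2 hg

/-! ### Cobase change of smooth chains -/

/-- Elementwise colimits are compatible with pushouts. -/
lemma IsColimitOn.pushout {A : Type w} [LinearOrder A] {G : A ⥤ C} {s : Set A} {D : C}
    {q : ∀ a, a ∈ s → (G.obj a ⟶ D)} (h : IsColimitOn G s q) {X X' : C} {g : X ⟶ X'}
    {u : ∀ a, X ⟶ G.obj a} {G' : A ⥤ C} {l : ∀ a, G.obj a ⟶ G'.obj a} {r : ∀ a, X' ⟶ G'.obj a}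
    (sq : ∀ a, IsPushout (u a) g (l a) (r a))
    (hl : ∀ a b (h : a ≤ b), l a ≫ G'.map (homOfLE h) = G.map (homOfLE h) ≫ l b)
    (hr : ∀ a b (h : a ≤ b), r a ≫ G'.map (homOfLE h) = r b)
    {u' : X ⟶ D} (hu' : ∀ a (ha : a ∈ s), u a ≫ q a ha = u')
    {D' : C} {l' : D ⟶ D'} {r' : X' ⟶ D'} (sq' : IsPushout u' g l' r')
    {q' : ∀ a, a ∈ s → (G'.obj a ⟶ D')} (hq' : ∀ a (ha : a ∈ s), l a ≫ q' a ha = q a ha ≫ l')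
    (hq'' : ∀ a (ha : a ∈ s), r a ≫ q' a ha = r') (hs : s.Nonempty) :
    IsColimitOn G' s q' := by
  intro T φ hφ
  -- Nonemptiness supplies the component X' → T of the cocone; by comparability it does not depend
  -- on the index.
  obtain ⟨a₀, ha₀⟩ := hs
  have h₁ (a b : A) (ha : a ∈ s) (hb : b ∈ s) (hab : a ≤ b) : r a ≫ φ a ha = r b ≫ φ b hb := by
    rw [← hφ a b ha hb hab, reassoc_of% hr a b hab]
  have h₂ (a : A) (ha : a ∈ s) : r a ≫ φ a ha = r a₀ ≫ φ a₀ ha₀ :=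
    (le_total a a₀).elim (h₁ a a₀ ha ha₀) (fun h => (h₁ a₀ a ha₀ ha h).symm)
  obtain ⟨ψ, h₃, h₄⟩ := h T (fun a ha => l a ≫ φ a ha) (fun a b ha hb hab => by
    rw [← hφ a b ha hb hab, reassoc_of% hl a b hab])
  have h₅ : u' ≫ ψ = g ≫ r a₀ ≫ φ a₀ ha₀ := by
    rw [← hu' a₀ ha₀, Category.assoc, h₃, reassoc_of% (sq a₀).w]
  refine ⟨sq'.desc ψ (r a₀ ≫ φ a₀ ha₀) h₅, fun a ha => ?_, fun ψ' hψ' => ?_⟩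
  · apply (sq a).hom_ext
    · rw [reassoc_of% hq' a ha, sq'.inl_desc, h₃]
    · rw [reassoc_of% hq'' a ha, sq'.inr_desc]
      exact (h₂ a ha).symm
  · apply sq'.hom_ext
    · rw [sq'.inl_desc]
      exact h₄ _ (fun a ha => by rw [← reassoc_of% hq' a ha, hψ'])
    · rw [sq'.inr_desc, ← hψ' a₀ ha₀, reassoc_of% hq'' a₀ ha₀]

/-- The cobase change of a smooth chain. -/
noncomputable def SmoothChain.cobaseChange {W : MorphismProperty C}
    [W.IsStableUnderCobaseChange] {A : Type w} [LinearOrder A] [Nonempty A]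
    {X Z X' Z' : C} {f : X ⟶ Z} {g : X ⟶ X'} {h : Z ⟶ Z'} {f' : X' ⟶ Z'}
    (c : SmoothChain W A f) (sq : IsPushout f g h f')
    {P : A → C} {l : ∀ a, c.G.obj a ⟶ P a} {r : ∀ a, X' ⟶ P a}
    (sq₁ : ∀ a, IsPushout (c.u a) g (l a) (r a)) : SmoothChain W A f' :=
  have hm {a b : A} (k : a ⟶ b) : c.u a ≫ c.G.map k ≫ l b = g ≫ r b := by
    rw [← (sq₁ b).w, ← c.u_map (leOfHom k), Category.assoc]
    rfl
  have hv (a : A) : c.u a ≫ c.v a ≫ h = g ≫ f' := by rw [← sq.w, reassoc_of% c.fac a]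
  let G' : A ⥤ C :=
    { obj := P
      map k := (sq₁ _).desc _ _ (hm k)
      map_id a := (sq₁ a).hom_ext
        (by rw [IsPushout.inl_desc, CategoryTheory.Functor.map_id, Category.id_comp,
          Category.comp_id])
        (by rw [IsPushout.inr_desc, Category.comp_id])
      map_comp {a b d} k k' := (sq₁ a).hom_ext
        (by rw [IsPushout.inl_desc, IsPushout.inl_desc_assoc, Category.assoc, IsPushout.inl_desc,
          Functor.map_comp, Category.assoc])
        (by rw [IsPushout.inr_desc, IsPushout.inr_desc_assoc, IsPushout.inr_desc]) }
  let v (a : A) : P a ⟶ Z' := (sq₁ a).desc _ _ (hv a)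
  have inl_map (a b : A) (k : a ⟶ b) : l a ≫ G'.map k = c.G.map k ≫ l b :=
    IsPushout.inl_desc _ _ _ _
  have inr_map (a b : A) (k : a ⟶ b) : r a ≫ G'.map k = r b := IsPushout.inr_desc _ _ _ _
  have inl_v (a : A) : l a ≫ v a = c.v a ≫ h := IsPushout.inl_desc _ _ _ _
  have inr_v (a : A) : r a ≫ v a = f' := IsPushout.inr_desc _ _ _ _
  -- By cancellation of pushout squares, each transition map and each map to the target is a cobase
  -- change of the corresponding old one.
  have sq₂ (a b : A) (hab : a ≤ b) : IsPushout (c.G.map (homOfLE hab)) (l a) (l b)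
      (G'.map (homOfLE hab)) :=
    .of_left (by rw [c.u_map hab, inr_map]; exact sq₁ b) (inl_map _ _ _).symm (sq₁ a)
  have sq₃ (a : A) : IsPushout (c.v a) (l a) h (v a) :=
    .of_left (by rw [c.fac a, inr_v]; exact sq) (inl_v a).symm (sq₁ a)
  { G := G'
    u := r
    v := v
    u_map h := inr_map _ _ _
    map_v {a b} hab := by
      apply (sq₁ a).hom_ext
      · rw [reassoc_of% inl_map, inl_v, inl_v, reassoc_of% c.map_v hab]
      · rw [reassoc_of% inr_map, inr_v, inr_v]
    fac a := inr_v a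
    isIso_u a ha := by
      have := c.isIso_u a ha
      exact (sq₁ a).isIso_inr_of_isIso
    step {a b} hab := W.of_isPushout (sq₂ a b hab.le).flip (c.step hab)
    last a ha := W.of_isPushout (sq₃ a).flip (c.last a ha)
    isColimit a ha ha' := (c.isColimit a ha ha').pushout sq₁ (fun a b hab => inl_map _ _ _)
      (fun a b hab => inr_map _ _ _) (fun b hb => c.u_map (le_of_lt hb)) (sq₁ a)
      (fun b hb => inl_map _ _ _) (fun b hb => inr_map _ _ _)
      (not_isMin_iff.1 ha)
    isColimit_top ha := (c.isColimit_top ha).pushout sq₁ (fun a b hab => inl_map _ _ _)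
      (fun a b hab => inr_map _ _ _) (fun a _ => c.fac a) sq
      (fun a _ => inl_v a) (fun a _ => inr_v a) Set.univ_nonempty }

instance [HasPushouts C] (W : MorphismProperty C) [W.IsStableUnderCobaseChange] :
    (MorphismProperty.transfiniteCompositions.{w} W).IsStableUnderCobaseChange where
  of_isPushout {X X' Z Z' f g f' g'} sq hg := by
    obtain ⟨A, _, _, _, ⟨c⟩⟩ | hg := smoothChains_or_isIso_of_transfiniteCompositions hg
    · exact smoothChains_le_transfiniteCompositions W _
        ⟨A, inferInstance, inferInstance, inferInstance,
          ⟨c.cobaseChange sq.flip fun a => IsPushout.of_hasPushout (c.u a) _⟩⟩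
    · have := sq.isIso_inl_of_isIso
      exact transfiniteCompositions_of_isIso W _

end

/-! ### Lifting properties of 𝒮-monomorphisms and the Eklof lemma. -/

section Abelian

variable {K : Type u} [Category.{v} K] [Abelian K]

instance (𝒮 : ObjectProperty K) : (monoWithCokernelIn 𝒮).IsStableUnderCobaseChange where
  of_isPushout {X X' Z Z' f g f' g'} sq hg := by
    have := isIso_cokernel_map_of_isPushout sq.flip
    exact ⟨(MorphismProperty.monomorphisms K).of_isPushout sq hg.1,
      (𝒮.isoClosure.prop_iff_of_iso (asIso (cokernel.map _ _ _ _ sq.flip.w))).1 hg.2⟩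

/-- The epimorphisms with kernel in a given class. -/
def epiWithKernelIn (ℬ : ObjectProperty K) : MorphismProperty K :=
  fun E _ p => ∃ (B : K) (i : B ⟶ E) (zero : i ≫ p = 0),
    ℬ B ∧ (ShortComplex.mk i p zero).ShortExact

lemma monoWithCokernelIn_le_llp (𝒮 : ObjectProperty K) :
    monoWithCokernelIn 𝒮 ≤ (epiWithKernelIn (rightPerp 𝒮)).llp := by
  rintro X Y f ⟨_, S, hS, ⟨e⟩⟩ E F p ⟨B, i, zero, hB, h⟩
  refine hasLiftingProperty_of_extOneVanishes (f := f) (π := cokernel.π f ≫ e.hom) (w₁ := by simp)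
    ?_ h (hB S hS)
  have : Epi (cokernel.π f ≫ e.hom) := epi_comp _ _
  exact { exact := ShortComplex.exact_of_g_is_cokernel _
            (CokernelCofork.IsColimit.ofπ' _ _ fun {T} t ht =>
              ⟨e.inv ≫ cokernel.desc f t ht, by simp⟩) }

/-- The Eklof lemma in lifting form: limit steps use only the universal property of the colimit. -/
lemma transfiniteCompositions_monoWithCokernelIn_le_llp (𝒮 : ObjectProperty K) :
    MorphismProperty.transfiniteCompositions.{w} (monoWithCokernelIn 𝒮) ≤
      (epiWithKernelIn (rightPerp 𝒮)).llp :=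
  (MorphismProperty.transfiniteCompositions_monotone (monoWithCokernelIn_le_llp 𝒮)).trans
    (MorphismProperty.transfiniteCompositions_le _)

lemma filt_le_leftPerp (𝒮 : ObjectProperty K) :
    filt.{w} 𝒮 ≤ leftPerp (rightPerp 𝒮) := by
  intro X hX B hB
  refine extOneVanishes_of_forall_exists_section fun E i p zero h => ?_
  have := transfiniteCompositions_monoWithCokernelIn_le_llp 𝒮 _ hX p ⟨B, i, zero, hB, h⟩
  have sq : CommSq (0 : 0 ⟶ E) (0 : (0 : K) ⟶ X) p (𝟙 X) := ⟨by simp⟩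
  exact ⟨sq.lift, sq.fac_right⟩

/-- If `X ⟶ Y` is a transfinite composition of `𝒮`-monomorphisms, then its cokernel
is in `filt 𝒮`. -/
lemma filt_cokernel (𝒮 : ObjectProperty K) {X Y : K} {f : X ⟶ Y}
    (hf : MorphismProperty.transfiniteCompositions.{w} (monoWithCokernelIn 𝒮) f) :
    filt.{w} 𝒮 (cokernel f) :=
  -- The cokernel is a cobase change of `f` along X → 0; `f` itself need not be mono.
  have sq : IsPushout f (0 : X ⟶ 0) (cokernel.π f) (0 : 0 ⟶ cokernel f) :=
    { w := by simp
      isColimit' := ⟨PushoutCocone.IsColimit.mk _ (fun s => cokernel.desc f s.inl (by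
          rw [s.condition, zero_comp]))
        (by simp) (fun s => (isZero_zero K).eq_of_src _ _)
        (fun s m h _ => by simp [← cancel_epi (cokernel.π f), h])⟩ }
  MorphismProperty.of_isPushout (P := MorphismProperty.transfiniteCompositions.{w} _) sq.flip hf

end Abelian

/-! ### A small set of test monomorphisms for 𝒮^⊥. -/

section Presentation

/-- A locally presentable category has a small separating set of objects. -/
lemma exists_small_isSeparating (K : Type u) [Category.{v} K] [IsLocallyPresentable.{w} K] :
    ∃ (P : ObjectProperty K) (_ : ObjectProperty.Small.{w} P), P.IsSeparating := by
  obtain ⟨κ, _, _⟩ := IsLocallyPresentable.exists_cardinal.{w} K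
  obtain ⟨P, hP, h⟩ := HasCardinalFilteredGenerator.exists_small_generator K κ
  exact ⟨P, hP, h.isStrongGenerator.isSeparating⟩

lemma locallySmall_of_isLocallyPresentable (K : Type u) [Category.{v} K]
    [IsLocallyPresentable.{w} K] : LocallySmall.{w} K := by
  obtain ⟨κ, _, _⟩ := IsLocallyPresentable.exists_cardinal.{w} K
  infer_instance

lemma hasColimitsOfSize_of_isLocallyPresentable (K : Type u) [Category.{v} K]
    [IsLocallyPresentable.{w} K] :
    HasColimitsOfSize.{w, w} K := by
  obtain ⟨κ, _, _⟩ := IsLocallyPresentable.exists_cardinal.{w} K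
  infer_instance

variable {K : Type u} [Category.{v} K] [Abelian K]

/-- Let `d : Q ⟶ S` be an epimorphism with kernel `k`. If all morphisms from the kernel to `Y`
extend to `Q`, then every extension of `S` by `Y` that receives a map from `Q` over `S` splits. -/
lemma exists_section_of_extends {Q S Y E : K} {d : Q ⟶ S} [Epi d] {i : Y ⟶ E} {p : E ⟶ S}
    {zero : i ≫ p = 0} (h : (ShortComplex.mk i p zero).ShortExact) (e : Q ⟶ E) (he : e ≫ p = d)
    (hY : ∀ a : kernel d ⟶ Y, ∃ b : Q ⟶ Y, kernel.ι d ≫ b = a) :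
    ∃ s : S ⟶ E, s ≫ p = 𝟙 S := by
  have : Mono i := h.mono_f
  -- On the kernel of `d`, the map `e` lands in Y. Subtracting an extension of this restriction to Q
  -- leaves a map that descends to the section.
  let a : kernel d ⟶ Y := h.exact.lift (kernel.ι d ≫ e) (by simp [he])
  have ha : a ≫ i = kernel.ι d ≫ e := h.exact.lift_f _ _
  obtain ⟨b, hb⟩ := hY a
  have hd : kernel.ι d ≫ (e - b ≫ i) = 0 := by
    rw [Preadditive.comp_sub, reassoc_of% hb, ha, sub_self]
  have hs : (ShortComplex.mk (kernel.ι d) d (kernel.condition d)).Exact :=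
    ShortComplex.exact_kernel d
  refine ⟨hs.desc (e - b ≫ i) hd, ?_⟩
  have hs' : d ≫ hs.desc (e - b ≫ i) hd = e - b ≫ i := hs.g_desc _ _
  rw [← cancel_epi d, reassoc_of% hs', Preadditive.sub_comp, Category.assoc, zero, he, comp_zero,
    sub_zero, Category.comp_id]

/-- There is a small set of `𝒮`-monomorphisms which detects `rightPerp 𝒮`. -/
lemma exists_small_monoWithCokernelIn [IsLocallyPresentable.{w} K] (𝒮 : ObjectProperty K)
    [ObjectProperty.Small.{w} 𝒮] :
    ∃ (I : Type w) (A B : I → K) (i : ∀ s, A s ⟶ B s), (∀ s, monoWithCokernelIn 𝒮 (i s)) ∧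
      ∀ Y : K, (∀ s (a : A s ⟶ Y), ∃ b : B s ⟶ Y, i s ≫ b = a) → rightPerp 𝒮 Y := by
  obtain ⟨P, _, hP⟩ := exists_small_isSeparating.{w} K
  have : LocallySmall.{w} K := locallySmall_of_isLocallyPresentable K
  have : HasColimitsOfSize.{w, w} K := hasColimitsOfSize_of_isLocallyPresentable K
  let H (S : K) : Type w := Shrink.{w} (Σ G : Subtype P, G.1 ⟶ S)
  let g {S : K} (h : H S) : K := ((equivShrink _).symm h).1.1
  let m {S : K} (h : H S) : g h ⟶ S := ((equivShrink _).symm h).2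
  -- In place of a projective cover, all epimorphisms onto S given by sets `T` of maps from
  -- generators are used; there is only a small set of them.
  let d {S : K} (T : Set (H S)) : (∐ fun h : T => g h.1) ⟶ S := Sigma.desc fun h => m h.1
  let S' (s : Shrink.{w} (Subtype 𝒮)) : K := ((equivShrink _).symm s).1
  refine ⟨Σ s : Shrink.{w} (Subtype 𝒮), {T : Set (H (S' s)) // Epi (d T)},
    fun s => kernel (d s.2.1), fun s => ∐ fun h : s.2.1 => g h.1, fun s => kernel.ι (d s.2.1),
    fun s => ⟨inferInstance, ?_⟩, fun Y hY S hS => ?_⟩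
  · have := s.2.2
    refine ⟨S' s.1, ((equivShrink _).symm s.1).2, ⟨?_⟩⟩
    exact (colimit.isColimit (parallelPair (kernel.ι (d s.2.1)) 0)).coconePointUniqueUpToIso
      (ShortComplex.exact_kernel (d s.2.1)).gIsCokernel
  · refine extOneVanishes_of_forall_exists_section fun E i p zero h => ?_
    obtain ⟨s, rfl⟩ : ∃ s, S' s = S := ⟨equivShrink _ ⟨S, hS⟩, by simp [S']⟩
    have : Epi p := h.epi_g
    -- Taking the maps that lift to E makes `d T` factor through `p`. It is epi because the
    -- generators separate maps out of E.
    let T : Set (H (S' s)) := {h | ∃ e : g h ⟶ E, e ≫ p = m h}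
    have hT : Epi (d T) := by
      refine ⟨fun {Z} x y hxy => ?_⟩
      rw [← cancel_epi p]
      refine hP _ _ fun G hG z => ?_
      obtain ⟨h, hh⟩ : ∃ h : H (S' s), (equivShrink _).symm h = ⟨⟨G, hG⟩, z ≫ p⟩ :=
        ⟨equivShrink _ ⟨⟨G, hG⟩, z ≫ p⟩, by simp⟩
      have key : ∀ (q : Σ G : Subtype P, G.1 ⟶ S' s), (equivShrink _).symm h = q →
          (∃ e : q.1.1 ⟶ E, e ≫ p = q.2) → q.2 ≫ x = q.2 ≫ y := by
        rintro _ rfl hq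
        have := Sigma.ι (fun h : T => g h.1) ⟨h, hq⟩ ≫= hxy
        rw [Sigma.ι_desc_assoc, Sigma.ι_desc_assoc] at this
        exact this
      simpa using key _ hh ⟨z, rfl⟩
    exact exists_section_of_extends h (d := d T) (Sigma.desc fun h => h.2.choose)
      (Sigma.hom_ext _ _ fun h => by
        rw [Sigma.ι_desc_assoc, Sigma.ι_desc]; exact h.2.choose_spec) (hY ⟨s, T, hT⟩)

end Presentation

/-! ### Attaching cells one at a time along a well-order. -/

section Attach

variable {C : Type u} [Category.{v} C]

/-- The result of attaching to `X` the objects `B t`, for `t ∈ U`, along `i t : A t ⟶ B t`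
and `a t : A t ⟶ X`. -/
structure Attachment {T : Type w} {A B : T → C} (i : ∀ t, A t ⟶ B t) {X : C}
    (a : ∀ t, A t ⟶ X) (U : Set T) where
  /-- the object -/
  P : C
  /-- the map from `X` -/
  r : X ⟶ P
  /-- the map from `B t` -/
  b (t : T) : t ∈ U → (B t ⟶ P)
  w (t : T) (ht : t ∈ U) : i t ≫ b t ht = a t ≫ r
  desc {Z : C} (φ : X ⟶ Z) (β : ∀ t, t ∈ U → (B t ⟶ Z))
    (h : ∀ t ht, i t ≫ β t ht = a t ≫ φ) : P ⟶ Z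
  r_desc {Z : C} (φ : X ⟶ Z) (β : ∀ t, t ∈ U → (B t ⟶ Z))
    (h : ∀ t ht, i t ≫ β t ht = a t ≫ φ) : r ≫ desc φ β h = φ
  b_desc {Z : C} (φ : X ⟶ Z) (β : ∀ t, t ∈ U → (B t ⟶ Z))
    (h : ∀ t ht, i t ≫ β t ht = a t ≫ φ) (t : T) (ht : t ∈ U) : b t ht ≫ desc φ β h = β t ht
  hom_ext {Z : C} {f g : P ⟶ Z} (h : r ≫ f = r ≫ g) (h' : ∀ t ht, b t ht ≫ f = b t ht ≫ g) : f = g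

namespace Attachment

variable {T : Type w} {A B : T → C} {i : ∀ t, A t ⟶ B t} {X : C} {a : ∀ t, A t ⟶ X}

/-- Attachments are pushouts of coproducts. -/
noncomputable def ofHasColimits [HasColimitsOfSize.{w, w} C] (i : ∀ t, A t ⟶ B t)
    (a : ∀ t, A t ⟶ X) (U : Set T) : Attachment i a U :=
  have : HasPushouts C := hasColimitsOfSizeShrink.{0, 0, w, w} C |>.has_colimits_of_shape _
  let p : (∐ fun t : U => A t) ⟶ ∐ fun t : U => B t := Limits.Sigma.map fun t => i t
  let q : (∐ fun t : U => A t) ⟶ X := Sigma.desc fun t => a t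
  have hq {Z : C} (φ : X ⟶ Z) (β : ∀ t, t ∈ U → (B t ⟶ Z))
      (h : ∀ t ht, i t ≫ β t ht = a t ≫ φ) :
      q ≫ φ = p ≫ Sigma.desc fun t : U => β t.1 t.2 :=
    Sigma.hom_ext _ _ fun t => by simp [p, q, h t.1 t.2]
  { P := pushout q p
    r := pushout.inl q p
    b t ht := Sigma.ι (fun t : U => B t) ⟨t, ht⟩ ≫ pushout.inr q p
    w t ht := by
      have := Sigma.ι (fun t : U => A t) ⟨t, ht⟩ ≫= (pushout.condition (f := q) (g := p)).symm
      simpa [p, q] using this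
    desc φ β h := pushout.desc φ (Sigma.desc fun t : U => β t.1 t.2) (hq φ β h)
    r_desc φ β h := pushout.inl_desc _ _ _
    b_desc φ β h t ht := by rw [Category.assoc, pushout.inr_desc, Sigma.ι_desc]
    hom_ext h h' := pushout.hom_ext h (Sigma.hom_ext _ _ fun t => by
      simpa using h' t.1 t.2) }

/-- The map between attachments induced by an inclusion. -/
def map {U V : Set T} (D : Attachment i a U) (E : Attachment i a V) (h : U ⊆ V) : D.P ⟶ E.P :=
  D.desc E.r (fun t ht => E.b t (h ht)) (fun t ht => E.w t (h ht))

section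

variable {U V V' : Set T} (D : Attachment i a U) (E : Attachment i a V) (E' : Attachment i a V')

lemma r_map (h : U ⊆ V) : D.r ≫ D.map E h = E.r := D.r_desc _ _ _

lemma b_map (h : U ⊆ V) (t : T) (ht : t ∈ U) : D.b t ht ≫ D.map E h = E.b t (h ht) :=
  D.b_desc _ _ _ _ _

lemma map_map (h : U ⊆ V) (h' : V ⊆ V') :
    D.map E h ≫ E.map E' h' = D.map E' (h.trans h') :=
  D.hom_ext (by rw [reassoc_of% D.r_map E h, r_map, r_map])
    (fun t ht => by rw [reassoc_of% D.b_map E h t ht, b_map, b_map])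

lemma map_self (h : U ⊆ U) : D.map D h = 𝟙 _ :=
  D.hom_ext (by rw [r_map, Category.comp_id]) (fun t ht => by rw [b_map, Category.comp_id])

lemma isIso_r (h : U = ∅) : IsIso D.r := by
  subst h
  refine ⟨D.desc (𝟙 X) (fun t ht => ht.elim) (fun t ht => ht.elim), D.r_desc _ _ _, ?_⟩
  exact D.hom_ext (by rw [reassoc_of% D.r_desc, Category.comp_id, Category.id_comp])
    (fun t ht => ht.elim)

lemma isPushout_map (h : U ⊆ V) (t : T) (ht : t ∈ V) (ht' : t ∉ U)
    (h' : ∀ s ∈ V, s ∈ U ∨ s = t) :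
    IsPushout (i t) (a t ≫ D.r) (E.b t ht) (D.map E h) where
  w := by rw [E.w, Category.assoc, r_map]
  isColimit' := by
    classical
    have key (s : PushoutCocone (i t) (a t ≫ D.r)) : ∀ t' (ht' : t' ∈ V),
      ∃ β : B t' ⟶ s.pt, i t' ≫ β = a t' ≫ D.r ≫ s.inr ∧
        (∀ hU : t' ∈ U, β = D.b t' hU ≫ s.inr) ∧
        -- The `HEq` says that the new cell is sent by `s.inl`, across the identification t' = t;
        -- the equation beside it carries no information.
        (∀ e : t' = t, E.b t' ht' ≫ 𝟙 _ = E.b t' ht' ∧ HEq β s.inl) := by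
      intro t' ht''
      obtain h | rfl := h' t' ht''
      · exact ⟨D.b t' h ≫ s.inr, by rw [← Category.assoc, D.w, Category.assoc], fun _ => rfl,
          fun e => (ht' (e ▸ h)).elim⟩
      · exact ⟨s.inl, by rw [s.condition, Category.assoc], fun h => (ht' h).elim,
          fun _ => ⟨by simp, HEq.rfl⟩⟩
    choose β h₁ h₂ h₃ using key
    refine ⟨PushoutCocone.IsColimit.mk _ (fun s => E.desc (D.r ≫ s.inr) (β s) (h₁ s)) ?_ ?_ ?_⟩
    · intro s
      rw [E.b_desc]
      exact eq_of_heq (h₃ s t ht rfl).2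
    · intro s
      refine D.hom_ext ?_ (fun t' ht' => ?_)
      · rw [reassoc_of% D.r_map E h, E.r_desc]
      · rw [reassoc_of% D.b_map E h, E.b_desc, h₂]
    · intro s f hf hf'
      refine E.hom_ext ?_ (fun t' ht'' => ?_)
      · rw [E.r_desc, ← D.r_map E h, Category.assoc, hf']
      · rw [E.b_desc]
        obtain h₄ | rfl := h' t' ht''
        · rw [h₂ s t' ht'' h₄, ← hf', reassoc_of% D.b_map E h]
        · exact hf.trans (eq_of_heq (h₃ s t' ht rfl).2).symm

end

/-- The object obtained by attaching the cells before a given index,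
as a functor of the index. -/
def functor [Preorder T] (D : ∀ U : Set T, Attachment i a U) : T ⥤ C where
  obj t := (D (Set.Iio t)).P
  map h := (D _).map (D _) (Set.Iio_subset_Iio (leOfHom h))
  map_id _ := (D _).map_self _
  map_comp _ _ := ((D _).map_map _ _ _ _).symm

lemma existsUnique_desc [LinearOrder T] {U : T → Set T} (hU : Monotone U)
    (D : ∀ t, Attachment i a (U t)) {s V : Set T} (E : Attachment i a V) (hs : s.Nonempty)
    (hV : ∀ t ∈ s, U t ⊆ V) (hV' : ∀ x ∈ V, ∃ t ∈ s, x ∈ U t) {Z : C}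
    (φ : ∀ t, t ∈ s → ((D t).P ⟶ Z)) (hφ : ∀ t t' (ht : t ∈ s) (ht' : t' ∈ s) (h : t ≤ t'),
      (D t).map (D t') (hU h) ≫ φ t' ht' = φ t ht) :
    ∃! ψ : E.P ⟶ Z, ∀ t ht, (D t).map E (hV t ht) ≫ ψ = φ t ht := by
  obtain ⟨t₀, ht₀⟩ := hs
  have h₁ (t t' : T) (ht : t ∈ s) (ht' : t' ∈ s) (h : t ≤ t') :
      (D t).r ≫ φ t ht = (D t').r ≫ φ t' ht' := by
    rw [← hφ t t' ht ht' h, reassoc_of% (D t).r_map]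
  have h₁' (t t' : T) (ht : t ∈ s) (ht' : t' ∈ s) : (D t).r ≫ φ t ht = (D t').r ≫ φ t' ht' :=
    (le_total t t').elim (h₁ t t' ht ht') (fun h => (h₁ t' t ht' ht h).symm)
  have h₂ (x t t' : T) (hx : x ∈ U t) (hx' : x ∈ U t') (ht : t ∈ s) (ht' : t' ∈ s) (h : t ≤ t') :
      (D t).b x hx ≫ φ t ht = (D t').b x hx' ≫ φ t' ht' := by
    rw [← hφ t t' ht ht' h, reassoc_of% (D t).b_map]
  have h₂' (x t t' : T) (hx : x ∈ U t) (hx' : x ∈ U t') (ht : t ∈ s) (ht' : t' ∈ s) :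
      (D t).b x hx ≫ φ t ht = (D t').b x hx' ≫ φ t' ht' :=
    (le_total t t').elim (h₂ x t t' hx hx' ht ht') (fun h => (h₂ x t' t hx' hx ht' ht h).symm)
  choose n hn hn' using hV'
  refine ⟨E.desc ((D _).r ≫ φ t₀ ht₀) (fun x hx => (D _).b x (hn' x hx) ≫ φ _ (hn x hx))
    (fun x hx => ?_), fun t ht => (D _).hom_ext ?_ (fun x hx => ?_), fun ψ hψ => ?_⟩
  · rw [← Category.assoc, (D _).w, Category.assoc, h₁' _ t₀ _ ht₀]
  · rw [reassoc_of% (D t).r_map, E.r_desc, h₁' t t₀ ht ht₀]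
  · rw [reassoc_of% (D t).b_map, E.b_desc]
    exact h₂' _ _ _ _ _ _ _
  · refine E.hom_ext ?_ (fun x hx => ?_)
    · rw [E.r_desc, ← hψ t₀ ht₀, reassoc_of% (D t₀).r_map]
    · rw [E.b_desc, ← hψ _ (hn x hx), reassoc_of% (D (n x hx)).b_map]

lemma isColimitOn_functor [LinearOrder T] (D : ∀ U : Set T, Attachment i a U) {s V : Set T}
    (hs : s.Nonempty) (hV : ∀ t ∈ s, Set.Iio t ⊆ V) (hV' : ∀ x ∈ V, ∃ t ∈ s, x < t) :
    IsColimitOn (functor D) s (fun t ht => (D (Set.Iio t)).map (D V) (hV t ht)) :=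
  fun _ φ hφ => existsUnique_desc (fun _ _ h => Set.Iio_subset_Iio h) (fun t => D (Set.Iio t)) (D V)
    hs hV hV' φ hφ

/-- Attaching a nonempty family of objects is the composition of a smooth chain of
cobase changes. -/
lemma smoothChains_r [Nonempty T] {W : MorphismProperty C} [W.IsStableUnderCobaseChange]
    (D : ∀ U : Set T, Attachment i a U) (hi : ∀ t, W (i t)) :
    smoothChains.{w} W (D Set.univ).r := by
  -- Any well-order will do: a successor step attaches the single cell `t`.
  obtain ⟨_, _⟩ := exists_wellFoundedLT T
  refine ⟨T, inferInstance, inferInstance, inferInstance, ⟨{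
    G := functor D
    u t := (D _).r
    v t := (D _).map (D _) (Set.subset_univ _)
    u_map h := (D _).r_map _ _
    map_v h := (D _).map_map _ _ _ _
    fac t := (D _).r_map _ _
    isIso_u t ht := (D _).isIso_r ht.Iio_eq
    step {t t'} h := ?_
    last t ht := ?_
    isColimit t ht ht' := ?_
    isColimit_top h := ?_ }⟩⟩
  · exact W.of_isPushout ((D _).isPushout_map (D _) (Set.Iio_subset_Iio h.le) t h.lt
      (lt_irrefl t) (fun s hs => (not_lt.1 (fun hs' => h.2 hs' hs)).lt_or_eq)).flip (hi t)
  · exact W.of_isPushout ((D (Set.Iio t)).isPushout_map (D _) (Set.subset_univ _) t trivial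
      (lt_irrefl t) (fun s _ => lt_or_eq_of_le (ht.isTop s))).flip (hi t)
  · refine isColimitOn_functor D (not_isMin_iff.1 ht)
      (fun t' ht' => Set.Iio_subset_Iio (le_of_lt ht')) (fun x hx => ?_)
    by_contra! h
    exact ht' x ⟨hx, fun y hy hy' => (h y hy').not_gt hy⟩
  · exact isColimitOn_functor D Set.univ_nonempty (fun t _ => Set.subset_univ _)
      (fun x _ => (not_isMax_iff.1 (h x)).imp fun y hy => ⟨trivial, hy⟩)

end Attachment
end Attach

/-! ### The small object argument. -/

section Preenvelope

variable {K : Type u} [Category.{v} K]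

/-- If `i` is a small family of morphisms in `W`, and if not all the morphisms to `X`
extend along `i`, then they do so after composing with the composition of a smooth chain. -/
lemma exists_smoothChains_extends [HasColimitsOfSize.{w, w} K] [LocallySmall.{w} K]
    {W : MorphismProperty K} [W.IsStableUnderCobaseChange]
    {I : Type w} {A B : I → K} (i : ∀ s, A s ⟶ B s) (hi : ∀ s, W (i s)) (X : K)
    (hX : ¬ ∀ s (a : A s ⟶ X), ∃ b : B s ⟶ X, i s ≫ b = a) :
    ∃ (X' : K) (φ : X ⟶ X'), smoothChains.{w} W φ ∧
      ∀ s (a : A s ⟶ X), ∃ b : B s ⟶ X', i s ≫ b = a ≫ φ := by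
  let T : Type w := Σ s, Shrink.{w} (A s ⟶ X)
  have : Nonempty T := by
    push Not at hX
    obtain ⟨s, a, _⟩ := hX
    exact ⟨s, equivShrink _ a⟩
  let D (U : Set T) := Attachment.ofHasColimits (fun t : T => i t.1)
    (fun t => (equivShrink _).symm t.2) U
  refine ⟨_, _, Attachment.smoothChains_r D (fun t => hi t.1), fun s a => ?_⟩
  have := (D Set.univ).w ⟨s, equivShrink _ a⟩ trivial
  rw [Equiv.symm_apply_apply] at this
  exact ⟨_, this⟩

/-- There is a regular cardinal for which all the objects of a small family are presentable. -/
lemma exists_isCardinalPresentable [IsLocallyPresentable.{w} K] {I : Type w} (A : I → K) :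
    ∃ (κ : Cardinal.{w}) (_ : Fact κ.IsRegular), ∀ s, IsCardinalPresentable (A s) κ := by
  have h (s : I) : ∃ (κ : Cardinal.{w}) (_ : Fact κ.IsRegular), IsCardinalPresentable (A s) κ :=
    Functor.IsAccessible.exists_cardinal (F := coyoneda.obj (Opposite.op (A s)))
  choose κ _ _ using h
  obtain ⟨κ', h₁, h₂⟩ := HasCardinalLT.exists_regular_cardinal_forall.{w}
    (fun s => (κ s).ord.ToType)
  have : Fact κ'.IsRegular := ⟨h₁⟩
  exact ⟨κ', ⟨h₁⟩, fun s => isCardinalPresentable_of_le _ (κ := κ s)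
    (le_of_lt (by simpa [hasCardinalLT_iff_cardinal_mk_lt] using h₂ s))⟩

/-- The small object argument: it stops at the first stage at which all morphisms extend. -/
lemma exists_transfiniteCompositions_extends [IsLocallyPresentable.{w} K] [HasPushouts K]
    {W : MorphismProperty K} [W.IsStableUnderCobaseChange]
    {I : Type w} {A B : I → K} (i : ∀ s, A s ⟶ B s) (hi : ∀ s, W (i s)) (X : K) :
    ∃ (Y : K) (f : X ⟶ Y), MorphismProperty.transfiniteCompositions.{w} W f ∧
      ∀ s (a : A s ⟶ Y), ∃ b : B s ⟶ Y, i s ≫ b = a := by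
  have : LocallySmall.{w} K := locallySmall_of_isLocallyPresentable K
  have : HasColimitsOfSize.{w, w} K := hasColimitsOfSize_of_isLocallyPresentable K
  let Q (X : K) : Prop := ∀ s (a : A s ⟶ X), ∃ b : B s ⟶ X, i s ≫ b = a
  have H (X : K) : ∃ (X' : K) (φ : X ⟶ X'), ¬ Q X → smoothChains.{w} W φ ∧
      ∀ s (a : A s ⟶ X), ∃ b : B s ⟶ X', i s ≫ b = a ≫ φ := by
    by_cases hX : Q X
    · exact ⟨X, 𝟙 X, fun h => (h hX).elim⟩
    · obtain ⟨X', φ, h⟩ := exists_smoothChains_extends i hi X hX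
      exact ⟨X', φ, fun _ => h⟩
  choose succ toSucc hsucc using H
  obtain ⟨κ, _, hκ⟩ := exists_isCardinalPresentable A
  let J := κ.ord.ToType
  have : NoMaxOrder J := Cardinal.noMaxOrder (Cardinal.IsRegular.aleph0_le Fact.out)
  have : IsFiltered J := isFiltered_of_isCardinalFiltered J κ
  have : Nonempty J := IsFiltered.nonempty
  let := WellFoundedLT.toOrderBot J
  let := SuccOrder.ofLinearWellFoundedLT J
  let Φ : SmallObject.SuccStruct K := { X₀ := X, succ := succ, toSucc := toSucc }
  let c := Φ.transfiniteCompositionOfShapeιIteration J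
  have hΦ {X Y : K} {f : X ⟶ Y} (hf : Φ.prop f) (hX : ¬ Q X) :
      smoothChains.{w} W f := by
    rw [hf.fac]
    exact (MorphismProperty.cancel_right_of_respectsIso (smoothChains.{w} W) _ _).2 (hsucc X hX).1
  -- At a stage satisfying `Q`, the next map is not known to be a smooth chain. Cutting at the least
  -- such stage, or keeping the whole iteration if there is none, leaves only steps which are smooth
  -- chains.
  by_cases h : ∃ j, Q (c.F.obj j)
  · obtain ⟨j, hj, hj'⟩ := WellFounded.has_min (wellFounded_lt (α := J)) {j | Q (c.F.obj j)} h
    let d : (smoothChains.{w} W).TransfiniteCompositionOfShape (Set.Iic j)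
        (c.F.map (homOfLE bot_le : ⊥ ⟶ j)) :=
      { toTransfiniteCompositionOfShape := (c.iic j).toTransfiniteCompositionOfShape
        map_mem k hk := hΦ ((c.iic j).map_mem k hk) (fun hk' => hj' k.1 hk' (by
          obtain ⟨l, hl⟩ := not_isMax_iff.1 hk
          exact lt_of_lt_of_le hl l.2)) }
    refine ⟨c.F.obj j, c.isoBot.inv ≫ c.F.map (homOfLE bot_le : ⊥ ⟶ j), ?_, hj⟩
    exact (MorphismProperty.cancel_left_of_respectsIso
      (MorphismProperty.transfiniteCompositions.{w} W) _ _).2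
      (transfiniteCompositions_smoothChains_le W _
        (MorphismProperty.transfiniteCompositionsOfShape_le_transfiniteCompositions _ _ _ ⟨d⟩))
  · have h (j : J) : ¬ Q (c.F.obj j) := fun hj => h ⟨j, hj⟩
    let d : (smoothChains.{w} W).TransfiniteCompositionOfShape J (Φ.ιIteration J) :=
      { toTransfiniteCompositionOfShape := c.toTransfiniteCompositionOfShape
        map_mem j hj := hΦ (c.map_mem j hj) (h j) }
    refine ⟨_, Φ.ιIteration J, transfiniteCompositions_smoothChains_le W _
      (MorphismProperty.transfiniteCompositionsOfShape_le_transfiniteCompositions _ _ _ ⟨d⟩),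
      fun s a => ?_⟩
    -- As A s is κ-presentable and J is κ-filtered, `a` factors through a stage `j`, and it extends
    -- at the successor of `j`.
    obtain ⟨j, a', ha'⟩ := IsCardinalPresentable.exists_hom_of_isColimit κ c.isColimit a
    obtain ⟨b, hb⟩ := (hsucc _ (h j)).2 s a'
    have hp := c.map_mem j (not_isMax j)
    have hp' := TransfiniteComposition.map_incl c (Order.le_succ j)
    rw [hp.fac] at hp'
    refine ⟨b ≫ eqToHom hp.succ_eq ≫ c.incl.app (Order.succ j), ?_⟩
    rw [reassoc_of% hb, ← ha']
    exact congrArg (a' ≫ ·) ((Category.assoc _ _ _).symm.trans hp')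

end Preenvelope

/-! ### Special approximation sequences. -/

section Main

variable {K : Type u} [Category.{v} K] [Abelian K]

lemma exists_transfiniteCompositions_rightPerp [IsLocallyPresentable.{w} K]
    (𝒮 : ObjectProperty K) [ObjectProperty.Small.{w} 𝒮] (X : K) :
    ∃ (Y : K) (f : X ⟶ Y),
      MorphismProperty.transfiniteCompositions.{w} (monoWithCokernelIn 𝒮) f ∧ rightPerp 𝒮 Y := by
  obtain ⟨I, A, B, i, hi, h⟩ := exists_small_monoWithCokernelIn.{w} 𝒮
  obtain ⟨Y, f, hf, hY⟩ := exists_transfiniteCompositions_extends i hi X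
  exact ⟨Y, f, hf, h Y hY⟩

/-- A transfinite composition of monomorphisms may fail to be mono here. Lifting against B → 0,
whose kernel B is in 𝒮^⊥, extends `i` along `f`, and `i` is mono. -/
lemma exists_mono_transfiniteCompositions_rightPerp [IsLocallyPresentable.{w} K]
    (𝒮 : ObjectProperty K) [ObjectProperty.Small.{w} 𝒮] {X B : K} (i : X ⟶ B) [Mono i]
    (hB : rightPerp 𝒮 B) :
    ∃ (Y : K) (f : X ⟶ Y), MorphismProperty.transfiniteCompositions.{w} (monoWithCokernelIn 𝒮) f ∧
      rightPerp 𝒮 Y ∧ Mono f := by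
  obtain ⟨Y, f, hf, hY⟩ := exists_transfiniteCompositions_rightPerp.{w} 𝒮 X
  refine ⟨Y, f, hf, hY, ?_⟩
  have : HasLiftingProperty f (0 : B ⟶ 0) :=
    transfiniteCompositions_monoWithCokernelIn_le_llp 𝒮 _ hf _ ⟨B, 𝟙 B, comp_zero, hB,
      { exact := ShortComplex.exact_of_f_is_kernel _ (KernelFork.IsLimit.ofι' _ _ fun {T} t ht =>
          ⟨t, Category.comp_id t⟩)
        mono_f := inferInstance
        epi_g := ⟨fun _ _ _ => (isZero_zero K).eq_of_src _ _⟩ }⟩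
  have sq : CommSq i f (0 : B ⟶ 0) (0 : Y ⟶ 0) := ⟨by simp⟩
  exact mono_of_mono_fac sq.fac_left

lemma exists_shortExact_of_mono [IsLocallyPresentable.{w} K]
    (𝒮 : ObjectProperty K) [ObjectProperty.Small.{w} 𝒮] {X B : K} (i : X ⟶ B) [Mono i]
    (hB : rightPerp 𝒮 B) :
    ∃ (C F' : K) (f : X ⟶ C) (g : C ⟶ F') (zero : f ≫ g = 0),
      (ShortComplex.mk f g zero).ShortExact ∧ rightPerp 𝒮 C ∧ filt.{w} 𝒮 F' := by
  obtain ⟨C, f, hf, hC, _⟩ := exists_mono_transfiniteCompositions_rightPerp.{w} 𝒮 i hB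
  exact ⟨C, cokernel f, f, cokernel.π f, cokernel.condition f,
    { exact := ShortComplex.exact_cokernel f }, hC, filt_cokernel 𝒮 hf⟩

lemma shortExact_of_isPushout_kernel {P Y C F : K} {p : P ⟶ Y} [Epi p] {f : kernel p ⟶ C}
    {k : C ⟶ F} {f' : P ⟶ F} (sq : IsPushout f (kernel.ι p) k f') {g : F ⟶ Y}
    (zero : k ≫ g = 0) (hg : f' ≫ g = p) :
    (ShortComplex.mk k g zero).ShortExact := by
  have : Mono k := (MorphismProperty.monomorphisms K).of_isPushout sq
    (inferInstanceAs (Mono (kernel.ι p)))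
  have : Epi g := epi_of_epi_fac hg
  have hp : (ShortComplex.mk (kernel.ι p) p (kernel.condition p)).Exact :=
    ShortComplex.exact_kernel p
  suffices (ShortComplex.mk k g zero).Exact from { exact := this }
  refine ShortComplex.exact_of_g_is_cokernel _
    (CokernelCofork.IsColimit.ofπ' _ _ fun {T} t ht => ?_)
  have ht' : kernel.ι p ≫ f' ≫ t = 0 := by rw [← reassoc_of% sq.w, ht, comp_zero]
  have hd : p ≫ hp.desc (f' ≫ t) ht' = f' ≫ t := hp.g_desc _ _
  refine ⟨hp.desc (f' ≫ t) ht', sq.hom_ext ?_ ?_⟩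
  · rw [reassoc_of% zero, ht, zero_comp]
  · rw [reassoc_of% hg, hd]

/-- F is the pushout of kernel p → C' along kernel p → P. The map P → F is again a transfinite
composition of 𝒮-monomorphisms, so composing it with 0 → P puts F in Filt(𝒮); that kernel p → C' be
mono is not needed. -/
lemma exists_shortExact_of_epi [IsLocallyPresentable.{w} K]
    (𝒮 : ObjectProperty K) [ObjectProperty.Small.{w} 𝒮] {Y P : K} (p : P ⟶ Y) [Epi p]
    (hP : filt.{w} 𝒮 P) :
    ∃ (C' F : K) (f : C' ⟶ F) (g : F ⟶ Y) (zero : f ≫ g = 0),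
      (ShortComplex.mk f g zero).ShortExact ∧ rightPerp 𝒮 C' ∧ filt.{w} 𝒮 F := by
  obtain ⟨C', f, hf, hC'⟩ := exists_transfiniteCompositions_rightPerp.{w} 𝒮 (kernel p)
  have sq := IsPushout.of_hasPushout f (kernel.ι p)
  have hw : f ≫ (0 : C' ⟶ Y) = kernel.ι p ≫ p := by simp
  refine ⟨C', _, _, sq.desc 0 p hw, sq.inl_desc _ _ _,
    shortExact_of_isPushout_kernel sq _ (sq.inr_desc _ _ _), hC', ?_⟩
  have := transfiniteCompositions_comp hP (MorphismProperty.of_isPushout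
    (P := MorphismProperty.transfiniteCompositions.{w} _) sq.flip hf)
  rwa [zero_comp] at this

lemma isDirectSummand_of_shortExact {G C F : K} {f : C ⟶ F} {g : F ⟶ G} {zero : f ≫ g = 0}
    (h : (ShortComplex.mk f g zero).ShortExact) (hG : ExtOneVanishes G C) :
    IsDirectSummand G F := by
  obtain ⟨s, hs⟩ := hG.exists_section h
  have : Mono f := h.mono_f
  exact ⟨C, ⟨biprod.braiding G C ≪≫
    (ShortComplex.Splitting.ofExactOfSection _ h.exact s hs this).isoBinaryBiproduct.symm⟩⟩

end Main

end EklofTrlifaj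

theorem mainTheorem4 {K : Type u} [Category.{v} K] [Abelian K]
    [IsLocallyPresentable.{w} K]
    (𝒮 : ObjectProperty K) [ObjectProperty.Small.{w} 𝒮]
    (ℱ 𝒞 : ObjectProperty K) (h : EklofTrlifaj.IsCotorsionTheoryGeneratedBy 𝒮 ℱ 𝒞) :
    (∀ X : K, EklofTrlifaj.filt.{w} 𝒮 X → ℱ X) ∧
    (∀ (X B : K) (i : X ⟶ B), Mono i → 𝒞 B →
      ∃ (C F' : K) (f : X ⟶ C) (g : C ⟶ F') (zero : f ≫ g = 0),
        (ShortComplex.mk f g zero).ShortExact ∧ 𝒞 C ∧ EklofTrlifaj.filt.{w} 𝒮 F') ∧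
    (∀ (Y P : K) (p : P ⟶ Y), Epi p → EklofTrlifaj.filt.{w} 𝒮 P →
      ∃ (C' F : K) (f : C' ⟶ F) (g : F ⟶ Y) (zero : f ≫ g = 0),
        (ShortComplex.mk f g zero).ShortExact ∧ 𝒞 C' ∧ EklofTrlifaj.filt.{w} 𝒮 F) ∧
    (∀ (G P : K) (p : P ⟶ G), Epi p → ℱ G → EklofTrlifaj.filt.{w} 𝒮 P →
      ∃ Q : K, EklofTrlifaj.filt.{w} 𝒮 Q ∧ EklofTrlifaj.IsDirectSummand G Q) := by
  obtain rfl := h.eq_rightPerp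
  obtain rfl := h.left_eq
  refine ⟨EklofTrlifaj.filt_le_leftPerp 𝒮,
    fun X B i _ hB => EklofTrlifaj.exists_shortExact_of_mono 𝒮 i hB,
    fun Y P p _ hP => EklofTrlifaj.exists_shortExact_of_epi 𝒮 p hP,
    fun G P p _ hG hP => ?_⟩
  obtain ⟨C, F, f, g, zero, hS, hC, hF⟩ := EklofTrlifaj.exists_shortExact_of_epi.{w} 𝒮 p hP
  exact ⟨F, hF, EklofTrlifaj.isDirectSummand_of_shortExact hS (hG C hC)⟩
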